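/- **Setting.** Let $(M,g)=\mathbb H/\Gamma$ be a closed hyperbolic surface, where $\mathbb H=\{X\in\mathbb R^{2,1}:(X,X)^\sharp=-1,\ X_3\ge 1\}$ is the hyperboloid in $\mathbb R^{2,1}$ with inner product $(X,Y)^\sharp=X_1Y_1+X_2Y_2-X_3Y_3$, and $\Gamma\subset SO^+(2,1)$ is the image of $\pi_1(M)$ under a discrete faithful representation. Let $\mathfrak g=\mathfrak{so}(2,1)$ with the form $(A,B)^\sharp=\operatorname{Tr}(AB)$, let $ad(E)=\mathbb H\times_{Ad}\mathfrak g$ be the flat Lie algebra bundle over $M$, and for $X,Y\in\mathbb R^{2,1}$ put $X\times Y=YX^\sharp-XY^\sharp\in\mathfrak g$, where $X^\sharp=(\operatorname{diag}(1,1,-1)X)^T$. For $\phi\in\Omega^1(M,ad(E))$ let $\phi_{id}$ denote the pointwise orthogonal projection of the values of $\phi$ onto the subbundle $\{v\times X: v\in T_X\mathbb H\}$, on which $(\cdot,\cdot)^\sharp$ is positive definite. When $\phi=\phi_{id}$, let $s(\phi)$ be the pointwise largest singular value of $\phi$ as a homomorphism from $TM$ to that subbundle. **Measured laminations.** A geodesic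 lamination $\lambda$ on $M$ is a closed set that is a disjoint union of simple complete geodesics (its leaves). A flow-box is a bi-Lipschitz homeomorphism $F:[a,b]\times[c,d]\to R\subset M$, $F=F(t,s)$, with $F^{-1}(\lambda)=[a,b]\times C$ for a closed set $C\subset(c,d)$ of Hausdorff dimension $0$, each $F([a,b]\times\{s\})$, $s\in C$, being contained in a leaf. A measured geodesic lamination $(\lambda,\mu)$ is a geodesic lamination together with, for every flow-box, a finite Borel measure $\mu=\mu(s)$ on $[c,d]$ supported in $C$ (not necessarily of full support), these measures being compatible with changes of flow-boxes. **The measure and the length.** Given finitely many flow-boxes $F_i:[a_i,b_i]\times[c_i,d_i]\to R_i$ whose interiors cover $\lambda$ and a subordinate partition of unity $\psi_i$, let $B=e\times x$ be the generator of the geodesic flow of $\lambda$, where $e=\left|\frac{\partial F_i}{\partial t}\right|^{-1}\frac{\partial F_i}{\partial t}$ is the unit tangent to the leaf at $x=F_i(t,s)$. The standard Lie algebra valued transverse measure $dw=B\,d\mu$ is the functional $$dw(\phi)=\sum_i\int_{c_i}^{d_i}\int_{(a_i,b_i)\times\{s\}}(\psi_i\phi,B)^\sharp\,d\mu(s),\qquad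 \phi\in\Omega^1(M,ad(E)),$$ and the length of $(\lambda,\mu)$ is $$l_g(\lambda)=\sum_i\int_{c_i}^{d_i}\int_{[a_i,b_i]\times\{s\}}\psi_i\left|\frac{\partial F_i}{\partial t}\right|dt\,d\mu(s).$$ The flow-boxes and partitions of unity used for $dw$ and for $l_g(\lambda)$ may be chosen arbitrarily and independently of each other. The mass (total variation) of $dw$ is $$\|dw\|_{meas}=\sup\{dw(\phi):\phi\in\Omega^1(M,ad(E)),\ \phi=\phi_{id},\ s(\phi)\le\sqrt2\}.$$ **Theorem.** For every measured geodesic lamination $(\lambda,\mu)$ on a closed hyperbolic surface $(M,g)$, $$\|dw\|_{meas}=2\,l_g(\lambda).$$ -/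

import Mathlib

open scoped Matrix ContDiff ENNReal
open MeasureTheory

noncomputable section

/-! ### Minkowski space, the hyperboloid and its isometry group -/

/-- The Lorentzian inner product of signature `(2,1)` on `ℝ³`. -/
def mink (x y : Fin 3 → ℝ) : ℝ := x 0 * y 0 + x 1 * y 1 - x 2 * y 2

/-- The diagonal matrix `diag(1,1,-1)`. -/
def minkJ : Matrix (Fin 3) (Fin 3) ℝ := Matrix.diagonal ![1, 1, -1]

/-- The hyperbolic plane, as the upper sheet of the unit hyperboloid. -/
def hyperboloid : Set (Fin 3 → ℝ) := {x | mink x x = -1 ∧ 1 ≤ x 2}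

/-- The hyperbolic plane as a (topological) space. -/
abbrev HypPlane : Type := hyperboloid

/-- The group `SO⁺(2,1)`: real `3 × 3` matrices of determinant one which preserve the Lorentzian
inner product and the upper sheet of the hyperboloid. -/
def SOplus : Subgroup (Matrix.SpecialLinearGroup (Fin 3) ℝ) where
  carrier := {g | (∀ x y, mink (g.1 *ᵥ x) (g.1 *ᵥ y) = mink x y) ∧
    ∀ x, g.1 *ᵥ x ∈ hyperboloid ↔ x ∈ hyperboloid}
  one_mem' := by simp
  mul_mem' := by
    rintro g h ⟨hg, hg'⟩ ⟨hh, hh'⟩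
    refine ⟨fun x y => ?_, fun x => ?_⟩
    · simp only [Matrix.SpecialLinearGroup.coe_mul, ← Matrix.mulVec_mulVec]
      rw [hg, hh]
    · simp only [Matrix.SpecialLinearGroup.coe_mul, ← Matrix.mulVec_mulVec]
      rw [hg', hh']
  inv_mem' := by
    rintro g ⟨hg, hg'⟩
    have key : ∀ x : Fin 3 → ℝ, g.1 *ᵥ ((g⁻¹).1 *ᵥ x) = x := fun x => by
      rw [Matrix.mulVec_mulVec, ← Matrix.SpecialLinearGroup.coe_mul]
      simp
    refine ⟨fun x y => ?_, fun x => ?_⟩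
    · rw [← hg, key, key]
    · rw [← hg', key]

/-- The matrix of an element of `SO⁺(2,1)`. -/
abbrev matOf (g : SOplus) : Matrix (Fin 3) (Fin 3) ℝ := g.1.1

instance : MulAction SOplus HypPlane where
  smul g x := ⟨matOf g *ᵥ x.1, (g.2.2 x.1).2 x.2⟩
  one_smul x := Subtype.ext (by
    change (1 : Matrix (Fin 3) (Fin 3) ℝ) *ᵥ x.1 = x.1
    simp)
  mul_smul g h x := Subtype.ext (by
    change (matOf g * matOf h) *ᵥ x.1 = matOf g *ᵥ (matOf h *ᵥ x.1)
    rw [Matrix.mulVec_mulVec])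

/-- The Lie algebra `so(2,1)`: matrices which are skew for the Lorentzian inner product. -/
abbrev so21 : Submodule ℝ (Matrix (Fin 3) (Fin 3) ℝ) := skewAdjointMatricesSubmodule minkJ

/-- The invariant form `(A, B)♯ = Tr(AB)` on the Lie algebra. -/
def killing (A B : Matrix (Fin 3) (Fin 3) ℝ) : ℝ := (A * B).trace

/-- The cross product `X × Y = Y X♯ - X Y♯`, where `X♯ = (diag(1,1,-1) X)ᵀ`. -/
def cross (X Y : Fin 3 → ℝ) : Matrix (Fin 3) (Fin 3) ℝ :=
  Matrix.vecMulVec Y (minkJ *ᵥ X) - Matrix.vecMulVec X (minkJ *ᵥ Y)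

/-- `v` is a unit tangent vector of the hyperbolic plane at `x`. -/
def IsUnitTangent (x : HypPlane) (v : Fin 3 → ℝ) : Prop := mink v x.1 = 0 ∧ mink v v = 1

/-- The global chart `ℝ² → ℍ` of the hyperboloid, as the graph of `√(1 + p² + q²)`. A function on
the hyperbolic plane is smooth if and only if it is smooth in this chart. -/
def chart (p : ℝ × ℝ) : HypPlane :=
  ⟨![p.1, p.2, √(1 + p.1 ^ 2 + p.2 ^ 2)], by
    have h : (0 : ℝ) ≤ 1 + p.1 ^ 2 + p.2 ^ 2 := by positivity
    constructor
    · simp only [mink, Matrix.cons_val]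
      rw [Real.mul_self_sqrt h]
      ring
    · simp only [Matrix.cons_val]
      exact Real.one_le_sqrt.2 (by nlinarith [sq_nonneg p.1, sq_nonneg p.2])⟩

/-! ### Closed hyperbolic surfaces and bundle-valued forms -/

/-- The surface `M = ℍ / Γ`. -/
abbrev Surface (Γ : Subgroup SOplus) : Type := MulAction.orbitRel.Quotient Γ HypPlane

/-- The universal covering `ℍ → M = ℍ / Γ`. -/
def proj (Γ : Subgroup SOplus) (x : HypPlane) : Surface Γ := Quotient.mk _ x

/-- `Γ` is the (discrete, faithful) image of the fundamental group of a closed hyperbolic surface: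
it acts freely, properly discontinuously and cocompactly on the hyperbolic plane. -/
structure IsClosedSurfaceGroup (Γ : Subgroup SOplus) : Prop where
  free : ∀ (γ : Γ) (x : HypPlane), γ • x = x → γ = 1
  properlyDiscontinuous : ProperlyDiscontinuousSMul Γ HypPlane
  cocompact : CompactSpace (Surface Γ)

/-- `Ω¹(M, ad E)`, the smooth 1-forms on `M = ℍ / Γ` with values in the flat Lie algebra bundle
`ℍ ×_Ad so(2,1)`, that is, the `Γ`-equivariant smooth `so(2,1)`-valued 1-forms on `ℍ`.
A linear map on the tangent space at `x`, the orthogonal complement of `x`, is encoded as the linear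
map on `ℝ³` that extends it by zero on `x`. -/
structure LieForm (Γ : Subgroup SOplus) where
  toFun : HypPlane → (Fin 3 → ℝ) →ₗ[ℝ] Matrix (Fin 3) (Fin 3) ℝ
  normal : ∀ x, toFun x x.1 = 0
  mem_so21 : ∀ x v, toFun x v ∈ so21
  smooth : ∀ v i j, ContDiff ℝ ∞ (fun p : ℝ × ℝ => toFun (chart p) v i j)
  equivariant : ∀ (γ : Γ) (x : HypPlane) (v : Fin 3 → ℝ),
    toFun (γ • x) (matOf γ.1 *ᵥ v) = matOf γ.1 * toFun x v * matOf (γ⁻¹).1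

/-- The orthogonal projection of `A ∈ so(2,1)` onto the image of `β_x : T_x ℍ → so(2,1)`,
`β_x(v) = v × x`, which is the positive definite part of `so(2,1)` at `x`;
it is `β_x` after the evaluation `A ↦ A x`. -/
def projAt (x : HypPlane) (A : Matrix (Fin 3) (Fin 3) ℝ) : Matrix (Fin 3) (Fin 3) ℝ :=
  cross (A *ᵥ x.1) x.1

/-- The condition `φ_id = φ`. -/
def LieForm.IsTangential {Γ : Subgroup SOplus} (φ : LieForm Γ) : Prop :=
  ∀ x v, projAt x (φ.toFun x v) = φ.toFun x v

/-- The pointwise largest singular value (operator norm, `∞`-Schatten norm) `s(φ)` at `x` of a form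
with `φ_id = φ`, a homomorphism from `T_x ℍ` with the hyperbolic metric to the positive definite
part of `so(2,1)` with the metric `Tr(AB)`. -/
def LieForm.maxSingularValue {Γ : Subgroup SOplus} (φ : LieForm Γ) (x : HypPlane) : ℝ≥0∞ :=
  ⨆ (v : Fin 3 → ℝ) (_ : IsUnitTangent x v),
    ENNReal.ofReal √(killing (φ.toFun x v) (φ.toFun x v))

/-- The mass (total variation) with respect to the operator norm of a functional on
`Ω¹(M, ad E)`: the supremum of `ζ(φ)` over the forms with `φ_id = φ` and `s(φ) ≤ √2`. -/
def mass {Γ : Subgroup SOplus} (ζ : LieForm Γ → ℝ) : EReal :=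
  ⨆ (φ : LieForm Γ) (_ : φ.IsTangential) (_ : ∀ x, φ.maxSingularValue x ≤ ENNReal.ofReal √2),
    (ζ φ : EReal)

/-! ### Geodesic laminations, flow-boxes and transverse measures -/

/-- `ℓ` is a complete geodesic of the hyperbolic plane. -/
def IsCompleteGeodesic (ℓ : Set HypPlane) : Prop :=
  ∃ (x : HypPlane) (v : Fin 3 → ℝ), IsUnitTangent x v ∧
    ℓ = {y | ∃ t : ℝ, y.1 = Real.cosh t • x.1 + Real.sinh t • v}

/-- A geodesic lamination on `M = ℍ / Γ`: a closed set which is a disjoint union of simple complete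
geodesics. It is given by the lifts of its leaves, a `Γ`-invariant family of pairwise disjoint
complete geodesics of `ℍ` with closed union. -/
structure GeodesicLamination (Γ : Subgroup SOplus) where
  leaves : Set (Set HypPlane)
  geodesic : ∀ ℓ ∈ leaves, IsCompleteGeodesic ℓ
  disjoint : leaves.PairwiseDisjoint id
  invariant : ∀ (γ : Γ), ∀ ℓ ∈ leaves, (fun x => γ • x) '' ℓ ∈ leaves
  closed : IsClosed (⋃₀ leaves)

/-- The lamination as a subset of `M`. -/
def GeodesicLamination.carrier {Γ : Subgroup SOplus} (lam : GeodesicLamination Γ) :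
    Set (Surface Γ) :=
  proj Γ '' ⋃₀ lam.leaves

/-- A flow-box `[a,b] × [c,d] → R ⊆ M` of a geodesic lamination. As the rectangle is simply
connected, the map is given by a lift `F` to `ℍ`. The bi-Lipschitz condition is stated for the lift
in the ambient coordinates; since the rectangle is compact and the covering is a local isometry, it
is equivalent (given injectivity of the map to `M`) to the one for the hyperbolic distance of `M`.
The horizontal segments over `C` are pieces of leaves. -/
structure FlowBox {Γ : Subgroup SOplus} (lam : GeodesicLamination Γ) where
  a : ℝ
  b : ℝ
  c : ℝ
  d : ℝ
  hab : a < b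
  hcd : c < d
  F : ℝ × ℝ → HypPlane
  lipschitz : ∃ K : ℝ, ∀ p ∈ Set.Icc a b ×ˢ Set.Icc c d, ∀ q ∈ Set.Icc a b ×ˢ Set.Icc c d,
    dist (F p).1 (F q).1 ≤ K * dist p q
  antilipschitz : ∃ K : ℝ, ∀ p ∈ Set.Icc a b ×ˢ Set.Icc c d, ∀ q ∈ Set.Icc a b ×ˢ Set.Icc c d,
    dist p q ≤ K * dist (F p).1 (F q).1
  injective : Set.InjOn (fun p => proj Γ (F p)) (Set.Icc a b ×ˢ Set.Icc c d)
  C : Set ℝ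
  closed_C : IsClosed C
  C_subset : C ⊆ Set.Ioo c d
  dimH_C : dimH C = 0
  preimage : ∀ p ∈ Set.Icc a b ×ˢ Set.Icc c d, proj Γ (F p) ∈ lam.carrier ↔ p.2 ∈ C
  horizontal : ∀ s ∈ C, ∃ ℓ ∈ lam.leaves, ∀ t ∈ Set.Icc a b, F (t, s) ∈ ℓ

namespace FlowBox

variable {Γ : Subgroup SOplus} {lam : GeodesicLamination Γ} (R : FlowBox lam)

/-- The image `R ⊆ M` of the flow-box. -/
def image : Set (Surface Γ) := (fun p => proj Γ (R.F p)) '' (Set.Icc R.a R.b ×ˢ Set.Icc R.c R.d)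

/-- The derivative `∂F/∂t`. For `s ∈ C` it exists for almost every `t`, and is tangent to the leaf
that contains the horizontal segment at height `s`. -/
def dt (t s : ℝ) : Fin 3 → ℝ := deriv (fun τ => (R.F (τ, s)).1) t

/-- The hyperbolic length `|∂F/∂t|`. -/
def speed (t s : ℝ) : ℝ := √(mink (R.dt t s) (R.dt t s))

/-- The generator `B = e × x` of the geodesic flow of the lamination, where `e` is the unit tangent
vector at `x = F(t,s)` of the leaf in the direction of `∂F/∂t`. -/
def generator (t s : ℝ) : Matrix (Fin 3) (Fin 3) ℝ :=
  cross ((R.speed t s)⁻¹ • R.dt t s) (R.F (t, s)).1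

end FlowBox

/-- A transverse measure on a geodesic lamination: for every flow-box a finite Borel measure on
`[c,d]` supported in `C`, compatible with changes of flow-boxes, i.e. invariant under every
injective Borel holonomy map `h` from plaques of one flow-box to plaques of another that meet them.
It need not be of full support. -/
structure TransverseMeasure {Γ : Subgroup SOplus} (lam : GeodesicLamination Γ) where
  measure : FlowBox lam → Measure ℝ
  finite : ∀ R, IsFiniteMeasure (measure R)
  support : ∀ R : FlowBox lam, measure R R.Cᶜ = 0
  compatible : ∀ (R S : FlowBox lam) (E : Set ℝ) (h : ℝ → ℝ), MeasurableSet E → E ⊆ R.C →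
    Measurable h → Set.InjOn h E →
    (∀ s ∈ E, h s ∈ S.C ∧ ∃ t ∈ Set.Icc R.a R.b, ∃ t' ∈ Set.Icc S.a S.b,
      proj Γ (R.F (t, s)) = proj Γ (S.F (t', h s))) →
    measure R E = measure S (h '' E)

/-- Finitely many flow-boxes whose interiors cover the lamination, with a smooth partition of unity
subordinate to this cover. -/
structure FlowBoxPartition {Γ : Subgroup SOplus} (lam : GeodesicLamination Γ) where
  n : ℕ
  box : Fin n → FlowBox lam
  cover : lam.carrier ⊆ ⋃ i, interior (box i).image
  ψ : Fin n → Surface Γ → ℝ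
  smooth : ∀ i, ContDiffOn ℝ ∞ (fun p : ℝ × ℝ => ψ i (proj Γ (chart p)))
    {p | proj Γ (chart p) ∈ ⋃ j, interior (box j).image}
  nonneg : ∀ i x, 0 ≤ ψ i x
  supported : ∀ i, Function.support (ψ i) ⊆ interior (box i).image
  sum_eq_one : ∀ x ∈ lam.carrier, ∑ i, ψ i x = 1

namespace TransverseMeasure

variable {Γ : Subgroup SOplus} {lam : GeodesicLamination Γ} (μ : TransverseMeasure lam)

/-- The standard Lie algebra valued transverse measure `dw = B dμ`, as a functional on
`Ω¹(M, ad E)`: the sum over the flow-boxes of the integrals over `[c,d]`, against `μ`, of the line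
integrals of the scalar 1-form `(ψᵢ φ, B)♯` along the horizontal segments. -/
def standard (P : FlowBoxPartition lam) (φ : LieForm Γ) : ℝ :=
  ∑ i, ∫ s in Set.Icc (P.box i).c (P.box i).d, (∫ t in Set.Ioo (P.box i).a (P.box i).b,
    P.ψ i (proj Γ ((P.box i).F (t, s))) *
      killing (φ.toFun ((P.box i).F (t, s)) ((P.box i).dt t s)) ((P.box i).generator t s))
    ∂(μ.measure (P.box i))

/-- The length of the measured lamination. -/
def length (P : FlowBoxPartition lam) : ℝ :=
  ∑ i, ∫ s in Set.Icc (P.box i).c (P.box i).d, (∫ t in Set.Icc (P.box i).a (P.box i).b,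
    P.ψ i (proj Γ ((P.box i).F (t, s))) * (P.box i).speed t s) ∂(μ.measure (P.box i))

end TransverseMeasure

end

noncomputable section

lemma mink_self_nonneg_of_orthogonal {x u : Fin 3 → ℝ} (hx : x ∈ hyperboloid)
    (hu : mink u x = 0) : 0 ≤ mink u u := by
  obtain ⟨h1, h2⟩ := hx
  simp only [mink] at *
  have hx2 : 0 < x 2 ^ 2 := by positivity
  have key : (u 2 * x 2) ^ 2 ≤ (u 0 ^ 2 + u 1 ^ 2) * (x 2 ^ 2 - 1) := by
    have e1 : u 2 * x 2 = u 0 * x 0 + u 1 * x 1 := by linarith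
    have e2 : x 2 ^ 2 - 1 = x 0 ^ 2 + x 1 ^ 2 := by linarith
    rw [e1, e2]
    nlinarith [sq_nonneg (u 0 * x 1 - u 1 * x 0)]
  have : 0 ≤ (u 0 * u 0 + u 1 * u 1 - u 2 * u 2) * x 2 ^ 2 := by
    nlinarith [sq_nonneg (u 0), sq_nonneg (u 1)]
  exact nonneg_of_mul_nonneg_left this hx2

lemma eq_zero_of_mink_self_eq_zero {x u : Fin 3 → ℝ} (hx : x ∈ hyperboloid)
    (hu : mink u x = 0) (h0 : mink u u = 0) : u = 0 := by
  obtain ⟨h1, h2⟩ := hx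
  simp only [mink] at *
  have key : (u 2 * x 2) ^ 2 ≤ (u 0 ^ 2 + u 1 ^ 2) * (x 2 ^ 2 - 1) := by
    have e1 : u 2 * x 2 = u 0 * x 0 + u 1 * x 1 := by linarith
    have e2 : x 2 ^ 2 - 1 = x 0 ^ 2 + x 1 ^ 2 := by linarith
    rw [e1, e2]
    nlinarith [sq_nonneg (u 0 * x 1 - u 1 * x 0)]
  have h3 : u 0 ^ 2 + u 1 ^ 2 ≤ 0 := by
    have : u 0 ^ 2 + u 1 ^ 2 = u 2 ^ 2 := by linarith
    rw [this] at key ⊢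
    nlinarith
  have a0 : u 0 = 0 := by nlinarith [sq_nonneg (u 0), sq_nonneg (u 1)]
  have a1 : u 1 = 0 := by nlinarith [sq_nonneg (u 0), sq_nonneg (u 1)]
  have a2 : u 2 = 0 := by
    rw [a0, a1] at h0
    nlinarith
  ext i
  fin_cases i <;> assumption

lemma mink_smul_left (c : ℝ) (x y : Fin 3 → ℝ) : mink (c • x) y = c * mink x y := by
  simp [mink]; ring

lemma mink_smul_right (c : ℝ) (x y : Fin 3 → ℝ) : mink x (c • y) = c * mink x y := by
  simp [mink]; ring

lemma mink_add_left (x y z : Fin 3 → ℝ) : mink (x + y) z = mink x z + mink y z := by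
  simp [mink]; ring

lemma mink_add_right (x y z : Fin 3 → ℝ) : mink x (y + z) = mink x y + mink x z := by
  simp [mink]; ring

lemma mink_comm (x y : Fin 3 → ℝ) : mink x y = mink y x := by
  simp [mink]; ring

lemma cross_entry (X Y : Fin 3 → ℝ) (i j : Fin 3) :
    cross X Y i j = Y i * (![1, 1, -1] j * X j) - X i * (![1, 1, -1] j * Y j) := by
  simp [cross, minkJ, Matrix.vecMulVec_apply, Matrix.mulVec_diagonal]

lemma killing_cross_cross (u v x y : Fin 3 → ℝ) :
    killing (cross u x) (cross v y) =
      2 * (mink u y * mink x v - mink x y * mink u v) := by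
  simp only [killing, Matrix.trace, Matrix.diag, Matrix.mul_apply, Fin.sum_univ_three, cross_entry,
    mink, Matrix.cons_val]
  ring

lemma cross_mulVec (X Y Z : Fin 3 → ℝ) : cross X Y *ᵥ Z = mink X Z • Y - mink Y Z • X := by
  ext i
  simp only [Matrix.mulVec, dotProduct, Fin.sum_univ_three, cross_entry, mink, Matrix.cons_val,
    Pi.sub_apply, Pi.smul_apply, smul_eq_mul]
  ring

lemma cross_smul_left (c : ℝ) (X Y : Fin 3 → ℝ) : cross (c • X) Y = c • cross X Y := by
  ext i j
  simp only [cross_entry, Matrix.smul_apply, Pi.smul_apply, smul_eq_mul]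
  ring

lemma cross_add_left (X X' Y : Fin 3 → ℝ) : cross (X + X') Y = cross X Y + cross X' Y := by
  ext i j
  simp only [cross_entry, Matrix.add_apply, Pi.add_apply]
  ring

lemma cross_same (X : Fin 3 → ℝ) : cross X X = 0 := by
  ext i j
  simp [cross_entry]

lemma cross_mem_so21 (X Y : Fin 3 → ℝ) : cross X Y ∈ so21 := by
  rw [mem_skewAdjointMatricesSubmodule, Matrix.IsSkewAdjoint, Matrix.IsAdjointPair]
  ext i j
  fin_cases i <;> fin_cases j <;>
    simp [Matrix.mul_apply, minkJ, cross_entry, Matrix.transpose_apply,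
      Matrix.diagonal_apply] <;> ring

lemma mink_eq_dotProduct (x y : Fin 3 → ℝ) : mink x y = x ⬝ᵥ (minkJ *ᵥ y) := by
  simp [mink, minkJ, Matrix.mulVec_diagonal, dotProduct, Fin.sum_univ_three]; ring

lemma mink_mulVec_self_of_mem_so21 {A : Matrix (Fin 3) (Fin 3) ℝ} (hA : A ∈ so21)
    (x : Fin 3 → ℝ) : mink (A *ᵥ x) x = 0 := by
  rw [mem_skewAdjointMatricesSubmodule, Matrix.IsSkewAdjoint, Matrix.IsAdjointPair] at hA
  have h1 : mink (A *ᵥ x) x = x ⬝ᵥ ((Aᵀ * minkJ) *ᵥ x) := by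
    rw [mink_eq_dotProduct, ← Matrix.mulVec_mulVec, Matrix.dotProduct_mulVec x Aᵀ,
      Matrix.vecMul_transpose]
  have h2 : x ⬝ᵥ ((minkJ * A) *ᵥ x) = mink x (A *ᵥ x) := by
    rw [mink_eq_dotProduct, Matrix.mulVec_mulVec]
  have h3 : x ⬝ᵥ ((minkJ * -A) *ᵥ x) = - mink x (A *ᵥ x) := by
    rw [← h2, Matrix.mul_neg, Matrix.neg_mulVec, dotProduct_neg]
  have h4 := mink_comm (A *ᵥ x) x
  rw [hA, h3] at h1
  linarith

lemma minkJ_mul_of_SOplus (g : SOplus) : (matOf g)ᵀ * minkJ * matOf g = minkJ := by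
  ext i j
  have h := g.2.1 (Pi.single i 1) (Pi.single j 1)
  have e1 : mink (Pi.single i 1) (Pi.single j 1) = minkJ i j := by
    rw [mink_eq_dotProduct]; simp
  have e2 : mink ((matOf g) *ᵥ Pi.single i 1) ((matOf g) *ᵥ Pi.single j 1) =
      ((matOf g)ᵀ * minkJ * matOf g) i j := by
    rw [mink_eq_dotProduct, Matrix.mulVec_mulVec, Matrix.dotProduct_mulVec,
      ← Matrix.vecMul_transpose, Matrix.vecMul_vecMul, ← Matrix.dotProduct_mulVec]
    simp [Matrix.mul_assoc]
  rw [← e1, ← e2]; exact h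

lemma matOf_mul_matOf_inv (g : SOplus) : matOf g * matOf g⁻¹ = 1 := by
  rw [← Matrix.SpecialLinearGroup.coe_mul, ← Subgroup.coe_mul, mul_inv_cancel]
  rfl

lemma minkJ_matOf_mulVec (g : SOplus) (X : Fin 3 → ℝ) :
    minkJ *ᵥ (matOf g *ᵥ X) = (minkJ *ᵥ X) ᵥ* matOf g⁻¹ := by
  have h : minkJ * matOf g = (matOf g⁻¹)ᵀ * minkJ := by
    calc minkJ * matOf g = (matOf g * matOf g⁻¹)ᵀ * minkJ * matOf g := by
          rw [matOf_mul_matOf_inv]; simp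
      _ = (matOf g⁻¹)ᵀ * ((matOf g)ᵀ * minkJ * matOf g) := by
          rw [Matrix.transpose_mul]; simp only [Matrix.mul_assoc]
      _ = _ := by rw [minkJ_mul_of_SOplus]
  rw [Matrix.mulVec_mulVec, h, ← Matrix.mulVec_mulVec, Matrix.mulVec_transpose]

lemma cross_matOf_mulVec (g : SOplus) (X Y : Fin 3 → ℝ) :
    cross (matOf g *ᵥ X) (matOf g *ᵥ Y) = matOf g * cross X Y * matOf g⁻¹ := by
  simp only [cross, minkJ_matOf_mulVec, Matrix.mul_sub, Matrix.sub_mul, Matrix.mul_vecMulVec,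
    Matrix.vecMulVec_mul]

/-- The tautological form `v ↦ v × x` in `Ω¹(M, ad E)`. -/
def idForm (Γ : Subgroup SOplus) : LieForm Γ where
  toFun x :=
    { toFun := fun v => cross v x.1
      map_add' := fun v w => cross_add_left v w x.1
      map_smul' := fun c v => cross_smul_left c v x.1 }
  normal x := cross_same x.1
  mem_so21 x v := cross_mem_so21 v x.1
  smooth v i j := by
    have hs : ContDiff ℝ ∞ (fun p : ℝ × ℝ => √(1 + p.1 ^ 2 + p.2 ^ 2)) :=
      ContDiff.sqrt (by fun_prop) (fun p => by positivity)
    have hc : ∀ k : Fin 3, ContDiff ℝ ∞ (fun p : ℝ × ℝ => (chart p).1 k) := by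
      intro k
      fin_cases k
      · exact contDiff_fst
      · exact contDiff_snd
      · exact hs
    simp only [LinearMap.coe_mk, AddHom.coe_mk, cross_entry]
    exact ((hc i).mul contDiff_const).sub (contDiff_const.mul (contDiff_const.mul (hc j)))
  equivariant γ x v := cross_matOf_mulVec γ.1 v x.1

lemma idForm_isTangential (Γ : Subgroup SOplus) : (idForm Γ).IsTangential := by
  intro x v
  change cross (cross v x.1 *ᵥ x.1) x.1 = cross v x.1
  rw [cross_mulVec, x.2.1, sub_eq_add_neg, cross_add_left, cross_smul_left, cross_same]
  simp

lemma idForm_maxSingularValue_le (Γ : Subgroup SOplus) (x : HypPlane) :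
    (idForm Γ).maxSingularValue x ≤ ENNReal.ofReal √2 := by
  refine iSup₂_le fun v hv => ENNReal.ofReal_le_ofReal (Real.sqrt_le_sqrt ?_)
  change killing (cross v x.1) (cross v x.1) ≤ 2
  rw [killing_cross_cross, hv.2, hv.1, x.2.1]
  simp

lemma killing_le_of_isTangential {Γ : Subgroup SOplus} {φ : LieForm Γ} (hφ : φ.IsTangential)
    {x : HypPlane} (hs : φ.maxSingularValue x ≤ ENNReal.ofReal √2) {e : Fin 3 → ℝ}
    (he : IsUnitTangent x e) : killing (φ.toFun x e) (cross e x.1) ≤ 2 := by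
  have h1 : ENNReal.ofReal √(killing (φ.toFun x e) (φ.toFun x e)) ≤ ENNReal.ofReal √2 :=
    (le_iSup₂ (f := fun (v : Fin 3 → ℝ) (_ : IsUnitTangent x v) =>
      ENNReal.ofReal √(killing (φ.toFun x v) (φ.toFun x v))) e he).trans hs
  rw [ENNReal.ofReal_le_ofReal_iff (Real.sqrt_nonneg _),
    Real.sqrt_le_sqrt_iff (by norm_num)] at h1
  set w := φ.toFun x e *ᵥ x.1 with hw
  have hwx : mink w x.1 = 0 := mink_mulVec_self_of_mem_so21 (φ.mem_so21 x e) x.1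
  have hφe : φ.toFun x e = cross w x.1 := (hφ x e).symm
  rw [hφe, killing_cross_cross] at h1 ⊢
  have hxw : mink x.1 w = 0 := by rw [mink_comm, hwx]
  rw [hwx, x.2.1] at h1 ⊢
  have h2 : 0 ≤ mink (w + (-1 : ℝ) • e) (w + (-1 : ℝ) • e) := by
    refine mink_self_nonneg_of_orthogonal x.2 ?_
    rw [mink_add_left, mink_smul_left, hwx, he.1]; simp
  simp only [mink_add_left, mink_add_right, mink_smul_left, mink_smul_right, he.2] at h2
  have := mink_comm e w
  nlinarith

section
variable {Γ : Subgroup SOplus} {lam : GeodesicLamination Γ} (R : FlowBox lam)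

lemma FlowBox.dt_orthogonal (t s : ℝ) : mink (R.dt t s) (R.F (t, s)).1 = 0 := by
  by_cases hd : DifferentiableAt ℝ (fun τ => (R.F (τ, s)).1) t
  · have h := hd.hasDerivAt
    rw [hasDerivAt_pi] at h
    have h3 := ((((h 0).mul (h 0)).add ((h 1).mul (h 1))).sub ((h 2).mul (h 2)))
    have hc : HasDerivAt (fun τ => (-1 : ℝ)) 0 t := hasDerivAt_const t _
    have he : (fun τ => (-1 : ℝ)) = ((fun τ => (R.F (τ, s)).1 0) * (fun τ => (R.F (τ, s)).1 0) +
        (fun τ => (R.F (τ, s)).1 1) * (fun τ => (R.F (τ, s)).1 1)) -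
        (fun τ => (R.F (τ, s)).1 2) * (fun τ => (R.F (τ, s)).1 2) := by
      ext τ
      exact ((R.F (τ, s)).2.1).symm
    rw [he] at hc
    have := hc.unique h3
    simp only [FlowBox.dt, mink] at *
    linarith
  · simp [FlowBox.dt, deriv_zero_of_not_differentiableAt hd, mink]

lemma FlowBox.speed_nonneg (t s : ℝ) : 0 ≤ R.speed t s := Real.sqrt_nonneg _

lemma FlowBox.speed_sq (t s : ℝ) : R.speed t s ^ 2 = mink (R.dt t s) (R.dt t s) :=
  Real.sq_sqrt (mink_self_nonneg_of_orthogonal (R.F (t, s)).2 (R.dt_orthogonal t s))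

lemma FlowBox.dt_eq_zero_of_speed {t s : ℝ} (h : R.speed t s = 0) : R.dt t s = 0 :=
  eq_zero_of_mink_self_eq_zero (R.F (t, s)).2 (R.dt_orthogonal t s) (by
    rw [← R.speed_sq, h]; simp)

lemma FlowBox.killing_idForm (t s : ℝ) :
    killing ((idForm Γ).toFun (R.F (t, s)) (R.dt t s)) (R.generator t s) = 2 * R.speed t s := by
  change killing (cross _ _) (cross _ _) = _
  rw [killing_cross_cross, mink_smul_right, mink_smul_right, mink_comm _ (R.dt t s),
    R.dt_orthogonal, (R.F (t, s)).2.1, ← R.speed_sq]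
  rcases eq_or_ne (R.speed t s) 0 with h | h
  · simp [h]
  · field_simp; ring

lemma FlowBox.killing_le {φ : LieForm Γ} (hφ : φ.IsTangential)
    (hs : ∀ x, φ.maxSingularValue x ≤ ENNReal.ofReal √2) (t s : ℝ) :
    killing (φ.toFun (R.F (t, s)) (R.dt t s)) (R.generator t s) ≤ 2 * R.speed t s := by
  rcases (R.speed_nonneg t s).eq_or_lt with h | h
  · rw [R.dt_eq_zero_of_speed h.symm, ← h]
    simp [killing]
  · have he : IsUnitTangent (R.F (t, s)) ((R.speed t s)⁻¹ • R.dt t s) := by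
      constructor
      · rw [mink_smul_left, R.dt_orthogonal]; simp
      · rw [mink_smul_left, mink_smul_right, ← R.speed_sq]; field_simp
    have h1 := killing_le_of_isTangential hφ (hs _) he
    rw [map_smul] at h1
    have h2 : ∀ (c : ℝ) (A B : Matrix (Fin 3) (Fin 3) ℝ),
        killing (c • A) B = c * killing A B := by
      intro c A B; simp [killing]
    rw [h2, inv_mul_le_iff₀ h] at h1
    rw [FlowBox.generator]
    linarith

end

lemma integral_mono_of_integrable_nonneg {α : Type*} [MeasurableSpace α] {ν : Measure α}
    {f g : α → ℝ} (hg : Integrable g ν) (hg0 : 0 ≤ᵐ[ν] g) (h : f ≤ᵐ[ν] g) :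
    ∫ x, f x ∂ν ≤ ∫ x, g x ∂ν := by
  by_cases hf : Integrable f ν
  · exact integral_mono_ae hf hg h
  · rw [integral_undef hf]
    exact integral_nonneg_of_ae hg0

instance : ContinuousConstSMul SOplus HypPlane where
  continuous_const_smul g := by
    refine Continuous.subtype_mk (f := fun x : HypPlane => matOf g *ᵥ x.1) ?_ _
    exact Continuous.matrix_mulVec continuous_const continuous_subtype_val

instance (Γ : Subgroup SOplus) : ContinuousConstSMul Γ HypPlane where
  continuous_const_smul γ := continuous_const_smul (γ : SOplus)

lemma isClosed_hyperboloid : IsClosed hyperboloid := by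
  apply IsClosed.inter
  · exact isClosed_eq (by unfold mink; fun_prop) continuous_const
  · exact isClosed_le continuous_const (continuous_apply 2)

instance : LocallyCompactSpace HypPlane := isClosed_hyperboloid.locallyCompactSpace

lemma coe_smul_hypPlane {Γ : Subgroup SOplus} (γ : Γ) (x : HypPlane) :
    (γ • x).1 = matOf γ.1 *ᵥ x.1 := rfl

section
variable {Γ : Subgroup SOplus}

lemma proj_eq_proj_iff {x y : HypPlane} : proj Γ x = proj Γ y ↔ ∃ γ : Γ, γ • y = x := by
  rw [proj, proj, Quotient.eq, MulAction.orbitRel_apply, MulAction.mem_orbit_iff]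

lemma proj_smul (γ : Γ) (x : HypPlane) : proj Γ (γ • x) = proj Γ x :=
  proj_eq_proj_iff.2 ⟨γ, rfl⟩

lemma continuous_proj : Continuous (proj Γ) := continuous_quot_mk

lemma measurable_proj : Measurable (proj Γ) := measurable_quotient_mk''

instance : OpensMeasurableSpace (Surface Γ) :=
  ⟨MeasurableSpace.generateFrom_le fun s hs => by
    change MeasurableSet (proj Γ ⁻¹' s)
    exact (IsOpen.preimage continuous_proj hs).measurableSet⟩

lemma IsClosedSurfaceGroup.t2Space (hΓ : IsClosedSurfaceGroup Γ) : T2Space (Surface Γ) := by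
  have := hΓ.properlyDiscontinuous
  exact t2Space_of_properlyDiscontinuousSMul_of_t2Space

lemma IsClosedSurfaceGroup.exists_nhds_injOn_proj (hΓ : IsClosedSurfaceGroup Γ) (x : HypPlane) :
    ∃ V ∈ nhds x, Set.InjOn (proj Γ) V := by
  have := hΓ.properlyDiscontinuous
  obtain ⟨V, hV, h⟩ := ProperlyDiscontinuousSMul.exists_nhds_image_smul_eq_self Γ x
  refine ⟨V, hV, fun y hy z hz hyz => ?_⟩
  obtain ⟨γ, rfl⟩ := proj_eq_proj_iff.1 hyz
  rw [hΓ.free γ x (h γ ⟨γ • z, ⟨z, hz, rfl⟩, hy⟩), one_smul]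

end

/-! ### Geodesics -/

lemma sq_le_of_isUnitTangent {x : HypPlane} {v : Fin 3 → ℝ} (hv : IsUnitTangent x v) :
    v 2 ^ 2 ≤ x.1 2 ^ 2 - 1 := by
  obtain ⟨h1, h2⟩ := hv
  have hx := x.2.1
  simp only [mink] at *
  have e1 : v 2 * x.1 2 = v 0 * x.1 0 + v 1 * x.1 1 := by linarith
  have e2 : x.1 2 ^ 2 - 1 = x.1 0 ^ 2 + x.1 1 ^ 2 := by linarith
  have e3 : v 0 ^ 2 + v 1 ^ 2 = 1 + v 2 ^ 2 := by linarith
  have : (v 2 * x.1 2) ^ 2 ≤ (v 0 ^ 2 + v 1 ^ 2) * (x.1 2 ^ 2 - 1) := by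
    rw [e1, e2]
    nlinarith [sq_nonneg (v 0 * x.1 1 - v 1 * x.1 0)]
  rw [e3] at this
  nlinarith

/-- The point at time `τ` on the geodesic with initial point `x` and initial velocity `v`. -/
def geod {x : HypPlane} {v : Fin 3 → ℝ} (hv : IsUnitTangent x v) (τ : ℝ) : HypPlane :=
  ⟨Real.cosh τ • x.1 + Real.sinh τ • v, by
    have h := Real.cosh_sq τ
    have hm : mink (Real.cosh τ • x.1 + Real.sinh τ • v) (Real.cosh τ • x.1 + Real.sinh τ • v)
        = -1 := by
      simp only [mink_add_left, mink_add_right, mink_smul_left, mink_smul_right, hv.2, hv.1, x.2.1,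
        mink_comm x.1 v]
      nlinarith
    refine ⟨hm, ?_⟩
    set z := Real.cosh τ • x.1 + Real.sinh τ • v with hz
    have hz2 : z 2 = Real.cosh τ * x.1 2 + Real.sinh τ * v 2 := by simp [hz]
    have h1 : 1 ≤ z 2 ^ 2 := by
      simp only [mink] at hm
      nlinarith [sq_nonneg (z 0), sq_nonneg (z 1)]
    have h2 : 0 < z 2 := by
      have a1 := sq_le_of_isUnitTangent hv
      have a2 := x.2.2
      have a3 := Real.cosh_pos τ
      have a4 : (Real.sinh τ * v 2) ^ 2 < (Real.cosh τ * x.1 2) ^ 2 := by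
        rw [mul_pow, mul_pow, h]
        nlinarith [sq_nonneg (Real.sinh τ), sq_nonneg (v 2)]
      have a5 := (abs_lt_of_sq_lt_sq' a4 (by positivity)).1
      linarith
    nlinarith⟩

section
variable {x : HypPlane} {v : Fin 3 → ℝ} (hv : IsUnitTangent x v)

lemma coe_geod (τ : ℝ) : (geod hv τ).1 = Real.cosh τ • x.1 + Real.sinh τ • v := rfl

lemma continuous_geod : Continuous (geod hv) := by
  refine Continuous.subtype_mk ?_ _
  fun_prop

lemma mink_geod (τ : ℝ) : mink (geod hv τ).1 v = Real.sinh τ := by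
  rw [coe_geod, mink_add_left, mink_smul_left, mink_smul_left, hv.2, mink_comm, hv.1]; simp

lemma arsinh_mink_geod (τ : ℝ) : Real.arsinh (mink (geod hv τ).1 v) = τ := by
  rw [mink_geod, Real.arsinh_sinh]

lemma sinh_smul_geod (τ₁ τ₂ τ : ℝ) : Real.sinh (τ₂ - τ₁) • (geod hv τ).1 =
    Real.sinh (τ₂ - τ) • (geod hv τ₁).1 + Real.sinh (τ - τ₁) • (geod hv τ₂).1 := by
  simp only [coe_geod, Real.sinh_sub]
  ext i
  simp only [Pi.add_apply, Pi.smul_apply, smul_eq_mul]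
  ring

end

lemma IsCompleteGeodesic.exists_eq_range {ℓ : Set HypPlane} (h : IsCompleteGeodesic ℓ) :
    ∃ (x : HypPlane) (v : Fin 3 → ℝ) (hv : IsUnitTangent x v), ℓ = Set.range (geod hv) := by
  obtain ⟨x, v, hv, rfl⟩ := h
  refine ⟨x, v, hv, ?_⟩
  ext y
  simp only [Set.mem_ofPred_eq, Set.mem_range, Subtype.ext_iff, coe_geod, eq_comm]

/-- A set is geodesically convex if it contains the geodesic segment between any two of its
points. -/
def GeodConvex (V : Set HypPlane) : Prop :=
  ∀ (x : HypPlane) (v : Fin 3 → ℝ) (hv : IsUnitTangent x v) (τ₁ τ₂ : ℝ), geod hv τ₁ ∈ V →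
    geod hv τ₂ ∈ V → ∀ τ ∈ Set.Icc τ₁ τ₂, geod hv τ ∈ V

lemma exists_geodConvex_nhds {x₀ : HypPlane} {O : Set HypPlane} (hO : O ∈ nhds x₀) :
    ∃ V ∈ nhds x₀, V ⊆ O ∧ GeodConvex V := by
  have hpos : ∀ y : HypPlane, 0 < y.1 2 := fun y => by linarith [y.2.2]
  set u := x₀.1 0 / x₀.1 2 with hu
  set w := x₀.1 1 / x₀.1 2 with hw
  let k : HypPlane → ℝ × ℝ := fun y => (y.1 0 / y.1 2, y.1 1 / y.1 2)
  let g : ℝ × ℝ → (Fin 3 → ℝ) := fun p => (√(1 - p.1 ^ 2 - p.2 ^ 2))⁻¹ • ![p.1, p.2, 1]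
  have hk : ∀ y : HypPlane, 1 - (k y).1 ^ 2 - (k y).2 ^ 2 = (y.1 2)⁻¹ ^ 2 := by
    intro y
    have h1 := y.2.1
    have h2 := hpos y
    simp only [mink] at h1
    simp only [k]
    field_simp
    linarith
  have hgk : ∀ y, g (k y) = y.1 := by
    intro y
    have h2 := hpos y
    simp only [g]
    rw [hk, Real.sqrt_sq (by positivity), inv_inv]
    ext i
    fin_cases i <;> simp [k] <;> field_simp
  have hg : ContinuousAt g (k x₀) := by
    have hne : √(1 - (k x₀).1 ^ 2 - (k x₀).2 ^ 2) ≠ 0 := by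
      rw [hk, Real.sqrt_sq (inv_nonneg.2 (hpos _).le)]
      exact (inv_pos.2 (hpos _)).ne'
    have h1 : Continuous fun p : ℝ × ℝ => √(1 - p.1 ^ 2 - p.2 ^ 2) := by fun_prop
    have h2 : Continuous fun p : ℝ × ℝ => (![p.1, p.2, 1] : Fin 3 → ℝ) := by fun_prop
    exact (h1.continuousAt.inv₀ hne).smul h2.continuousAt
  obtain ⟨O', hO', hO'O⟩ := mem_nhds_subtype _ _ _ |>.1 hO
  rw [← hgk x₀] at hO'
  obtain ⟨ε, hε, hball⟩ := Metric.mem_nhds_iff.1 (hg hO')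
  have hdiv : ∀ (y : HypPlane) (c : ℝ) (i : Fin 3),
      |y.1 i / y.1 2 - c| < ε ↔ |y.1 i - c * y.1 2| < ε * y.1 2 := by
    intro y c i
    have h2 := hpos y
    have : y.1 i / y.1 2 - c = (y.1 i - c * y.1 2) / y.1 2 := by field_simp
    rw [this, abs_div, abs_of_pos h2, div_lt_iff₀ h2]
  refine ⟨{y | |y.1 0 - u * y.1 2| < ε * y.1 2 ∧ |y.1 1 - w * y.1 2| < ε * y.1 2}, ?_, ?_, ?_⟩
  · refine IsOpen.mem_nhds ?_ ?_
    · have hc : ∀ i, Continuous fun y : HypPlane => y.1 i := fun i =>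
        (continuous_apply i).comp continuous_subtype_val
      apply IsOpen.inter
      · exact isOpen_lt ((hc 0).sub (continuous_const.mul (hc 2))).abs (continuous_const.mul (hc 2))
      · exact isOpen_lt ((hc 1).sub (continuous_const.mul (hc 2))).abs (continuous_const.mul (hc 2))
    · have h2 := hpos x₀
      have h3 : 0 < ε * x₀.1 2 := by positivity
      constructor
      · rw [hu, div_mul_cancel₀ _ h2.ne']; simpa using h3
      · rw [hw, div_mul_cancel₀ _ h2.ne']; simpa using h3
  · rintro y ⟨hy0, hy1⟩
    rw [← hdiv] at hy0 hy1
    apply hO'O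
    have : k y ∈ Metric.ball (k x₀) ε := by
      rw [Metric.mem_ball, Prod.dist_eq, max_lt_iff]
      exact ⟨hy0, hy1⟩
    have h3 := hball this
    rw [Set.mem_preimage, hgk] at h3
    exact h3
  · intro x v hv τ₁ τ₂ h₁ h₂ τ hτ
    rcases (hτ.1.trans hτ.2).eq_or_lt with h | h
    · have : τ = τ₁ := le_antisymm (by rw [h]; exact hτ.2) hτ.1
      rwa [this]
    have hs : 0 < Real.sinh (τ₂ - τ₁) := Real.sinh_pos_iff.2 (by linarith)
    have ha : 0 ≤ Real.sinh (τ₂ - τ) := Real.sinh_nonneg_iff.2 (by linarith [hτ.2])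
    have hb : 0 ≤ Real.sinh (τ - τ₁) := Real.sinh_nonneg_iff.2 (by linarith [hτ.1])
    have hab : 0 < Real.sinh (τ₂ - τ) ∨ 0 < Real.sinh (τ - τ₁) := by
      rcases hτ.1.eq_or_lt with h' | h'
      · exact Or.inl (Real.sinh_pos_iff.2 (by linarith))
      · exact Or.inr (Real.sinh_pos_iff.2 (by linarith))
    have key := sinh_smul_geod hv τ₁ τ₂ τ
    set S := Real.sinh (τ₂ - τ₁)
    set A := Real.sinh (τ₂ - τ)
    set B := Real.sinh (τ - τ₁)
    have hcomb : ∀ (c : ℝ) (i : Fin 3),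
        |(geod hv τ₁).1 i - c * (geod hv τ₁).1 2| < ε * (geod hv τ₁).1 2 →
        |(geod hv τ₂).1 i - c * (geod hv τ₂).1 2| < ε * (geod hv τ₂).1 2 →
        |(geod hv τ).1 i - c * (geod hv τ).1 2| < ε * (geod hv τ).1 2 := by
      intro c i h1 h2
      have k2 := congrFun key 2
      have ki := congrFun key i
      simp only [Pi.add_apply, Pi.smul_apply, smul_eq_mul] at k2 ki
      rw [abs_lt] at h1 h2 ⊢
      have m1 := mul_nonneg ha (sub_nonneg.2 h1.1.le)
      have m2 := mul_nonneg hb (sub_nonneg.2 h2.1.le)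
      have m3 := mul_nonneg ha (sub_nonneg.2 h1.2.le)
      have m4 := mul_nonneg hb (sub_nonneg.2 h2.2.le)
      rcases hab with hA | hB
      · have p1 := mul_pos hA (sub_pos.2 h1.1)
        have p2 := mul_pos hA (sub_pos.2 h1.2)
        constructor
        · refine lt_of_mul_lt_mul_left ?_ hs.le
          linear_combination p1 + m2 + c * k2 - ki - ε * k2
        · refine lt_of_mul_lt_mul_left ?_ hs.le
          linear_combination p2 + m4 + (-c) * k2 + ki - ε * k2
      · have p1 := mul_pos hB (sub_pos.2 h2.1)
        have p2 := mul_pos hB (sub_pos.2 h2.2)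
        constructor
        · refine lt_of_mul_lt_mul_left ?_ hs.le
          linear_combination p1 + m1 + c * k2 - ki - ε * k2
        · refine lt_of_mul_lt_mul_left ?_ hs.le
          linear_combination p2 + m3 + (-c) * k2 + ki - ε * k2
    exact ⟨hcomb u 0 h₁.1 h₂.1, hcomb w 1 h₁.2 h₂.2⟩

/-! ### Flow-boxes -/

lemma IsPreconnected.subsingleton_of_dimH_eq_zero {A C : Set ℝ} (hA : IsPreconnected A)
    (hAC : A ⊆ C) (hC : dimH C = 0) : A.Subsingleton := by
  by_contra hne
  obtain ⟨a, ha, b, hb, hab⟩ := (Set.not_subsingleton_iff.1 hne).exists_lt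
  have hsub : Set.Icc a b ⊆ C := (hA.Icc_subset ha hb).trans hAC
  have h1 : dimH (Set.Icc a b) = 1 := by
    rw [Real.dimH_of_nonempty_interior (by simpa [interior_Icc] using hab)]
    simp
  have := dimH_mono hsub
  rw [h1, hC] at this
  simp at this

namespace FlowBox

variable {Γ : Subgroup SOplus} {lam : GeodesicLamination Γ} (R : FlowBox lam)

/-- The domain `[a,b] × [c,d]` of a flow-box. -/
def rect : Set (ℝ × ℝ) := Set.Icc R.a R.b ×ˢ Set.Icc R.c R.d

lemma isCompact_rect : IsCompact R.rect := isCompact_Icc.prod isCompact_Icc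

lemma exists_lipschitzOnWith : ∃ K : NNReal, LipschitzOnWith K R.F R.rect := by
  obtain ⟨K, hK⟩ := R.lipschitz
  refine ⟨K.toNNReal, LipschitzOnWith.of_dist_le_mul fun p hp q hq => ?_⟩
  exact (hK p hp q hq).trans (mul_le_mul_of_nonneg_right (Real.le_coe_toNNReal K) dist_nonneg)

lemma continuousOn_F : ContinuousOn R.F R.rect := R.exists_lipschitzOnWith.choose_spec.continuousOn

/-- The flow-box as a map to the surface. -/
def toSurface (q : ℝ × ℝ) : Surface Γ := proj Γ (R.F q)

lemma continuousOn_toSurface : ContinuousOn R.toSurface R.rect :=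
  continuous_proj.comp_continuousOn R.continuousOn_F

lemma isEmbedding (hΓ : IsClosedSurfaceGroup Γ) :
    Topology.IsEmbedding (R.rect.domRestrict R.toSurface) := by
  have := hΓ.t2Space
  have := isCompact_iff_compactSpace.1 R.isCompact_rect
  exact (Continuous.isClosedEmbedding R.continuousOn_toSurface.domRestrict
    (Set.injOn_iff_injective.1 R.injective)).isEmbedding

lemma isCompact_C : IsCompact R.C :=
  isCompact_Icc.of_isClosed_subset R.closed_C (R.C_subset.trans Set.Ioo_subset_Icc_self)

lemma mk_mem_rect {t s : ℝ} (ht : t ∈ Set.Icc R.a R.b) (hs : s ∈ R.C) : (t, s) ∈ R.rect :=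
  ⟨ht, Set.Ioo_subset_Icc_self (R.C_subset hs)⟩

lemma mem_carrier {t s : ℝ} (ht : t ∈ Set.Icc R.a R.b) (hs : s ∈ R.C) :
    R.toSurface (t, s) ∈ lam.carrier :=
  (R.preimage _ (R.mk_mem_rect ht hs)).2 hs

/-- Points of a flow-box in a small neighbourhood of a point of the surface have parameters close
to those of that point. -/
lemma exists_nhds_forall_mem (hΓ : IsClosedSurfaceGroup Γ) {q₀ : ℝ × ℝ} (hq₀ : q₀ ∈ R.rect)
    {V : Set HypPlane} (hV : V ∈ nhds (R.F q₀)) :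
    ∃ U ∈ nhds (R.toSurface q₀), ∀ q ∈ R.rect, R.toSurface q ∈ U → R.F q ∈ V := by
  have h1 : R.rect.domRestrict R.F ⁻¹' V ∈ nhds (⟨q₀, hq₀⟩ : R.rect) :=
    R.continuousOn_F.domRestrict.continuousAt hV
  rw [(R.isEmbedding hΓ).nhds_eq_comap] at h1
  obtain ⟨U, hU, hUV⟩ := Filter.mem_comap.1 h1
  exact ⟨U, hU, fun q hq hqU => hUV (a := ⟨q, hq⟩) hqU⟩

/-- Points of a short piece of a leaf that stays in a flow-box lie on the same horizontal
segment. -/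
lemma snd_eq_of_geodConvex (hΓ : IsClosedSurfaceGroup Γ) {V : Set HypPlane} (hV : GeodConvex V)
    (hVR : ∀ y ∈ V, proj Γ y ∈ R.image) {ℓ : Set HypPlane} (hℓ : ℓ ∈ lam.leaves)
    {y₁ y₂ : HypPlane} (hy₁ : y₁ ∈ V) (hy₂ : y₂ ∈ V) (hℓ₁ : y₁ ∈ ℓ) (hℓ₂ : y₂ ∈ ℓ)
    {q₁ q₂ : ℝ × ℝ} (hq₁ : q₁ ∈ R.rect) (hq₂ : q₂ ∈ R.rect) (h₁ : R.toSurface q₁ = proj Γ y₁)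
    (h₂ : R.toSurface q₂ = proj Γ y₂) : q₁.2 = q₂.2 := by
  obtain ⟨x, v, hv, rfl⟩ := (lam.geodesic ℓ hℓ).exists_eq_range
  obtain ⟨τ₁, rfl⟩ := hℓ₁
  obtain ⟨τ₂, rfl⟩ := hℓ₂
  wlog hle : τ₁ ≤ τ₂ generalizing τ₁ τ₂ q₁ q₂
  · exact (this hq₂ hq₁ τ₂ hy₂ h₂ τ₁ hy₁ h₁ (le_of_not_ge hle)).symm
  set P : Set (Surface Γ) := (fun τ => proj Γ (geod hv τ)) '' Set.Icc τ₁ τ₂ with hP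
  have hPc : IsPreconnected P :=
    isPreconnected_Icc.image _ (continuous_proj.comp (continuous_geod hv)).continuousOn
  set g := R.rect.domRestrict R.toSurface with hg
  have himg : g '' (g ⁻¹' P) = P := by
    rw [Set.image_preimage_eq_iff]
    rintro _ ⟨τ, hτ, rfl⟩
    obtain ⟨q, hq, hqe⟩ := hVR _ (hV x v hv τ₁ τ₂ hy₁ hy₂ τ hτ)
    exact ⟨⟨q, hq⟩, hqe⟩
  have hpre : IsPreconnected (g ⁻¹' P) := by
    rw [← (R.isEmbedding hΓ).isInducing.isPreconnected_image, himg]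
    exact hPc
  have hsnd : IsPreconnected ((fun q : R.rect => q.1.2) '' (g ⁻¹' P)) :=
    hpre.image _ (by fun_prop)
  refine hsnd.subsingleton_of_dimH_eq_zero ?_ R.dimH_C ⟨⟨q₁, hq₁⟩, ?_, rfl⟩ ⟨⟨q₂, hq₂⟩, ?_, rfl⟩
  · rintro _ ⟨q, ⟨τ, hτ, hτq⟩, rfl⟩
    refine (R.preimage q.1 q.2).1 ?_
    change R.toSurface q.1 ∈ _
    rw [show R.toSurface q.1 = _ from hτq.symm]
    exact ⟨_, ⟨_, hℓ, τ, rfl⟩, rfl⟩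
  · exact ⟨τ₁, ⟨le_rfl, hle⟩, h₁.symm⟩
  · exact ⟨τ₂, ⟨hle, le_rfl⟩, h₂.symm⟩

end FlowBox

lemma lipschitzWith_arsinh : LipschitzWith 1 Real.arsinh := by
  refine lipschitzWith_of_nnnorm_deriv_le Real.differentiable_arsinh fun x => ?_
  have h1 : 1 ≤ √(1 + x ^ 2) := Real.one_le_sqrt.2 (by nlinarith [sq_nonneg x])
  rw [(Real.hasDerivAt_arsinh x).deriv, ← NNReal.coe_le_coe, coe_nnnorm, Real.norm_eq_abs,
    abs_of_nonneg (by positivity)]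
  simpa using inv_le_one_of_one_le₀ h1

lemma LipschitzOnWith.volume_image_eq_zero {f : ℝ → ℝ} {K : NNReal} {s N : Set ℝ}
    (hf : LipschitzOnWith K f s) (hN : N ⊆ s) (h0 : volume N = 0) : volume (f '' N) = 0 := by
  have h := (hf.mono hN).hausdorffMeasure_image_le (d := 1) zero_le_one
  rw [hausdorffMeasure_real, h0, mul_zero] at h
  exact le_antisymm h bot_le

/-- Integrals over sources and targets of a compact one-to-one relation agree, if the relation
transports one measure to the other. -/
lemma setLIntegral_fst_image_eq_snd_image {H : Set (ℝ × ℝ)} (hH : IsCompact H)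
    (h₁ : ∀ s s₁ s₂, (s, s₁) ∈ H → (s, s₂) ∈ H → s₁ = s₂)
    (h₂ : ∀ s s₁ s₂, (s₁, s) ∈ H → (s₂, s) ∈ H → s₁ = s₂) {α β : Measure ℝ}
    (hαβ : ∀ (E : Set ℝ) (h : ℝ → ℝ), MeasurableSet E → Measurable h → Set.InjOn h E →
      (∀ s ∈ E, (s, h s) ∈ H) → α E = β (h '' E))
    {g g' : ℝ → ℝ≥0∞} (hg' : Measurable g') (hgg' : ∀ s s', (s, s') ∈ H → g s = g' s') :
    ∫⁻ s in Prod.fst '' H, g s ∂α = ∫⁻ s in Prod.snd '' H, g' s ∂β := by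
  classical
  set E := Prod.fst '' H with hE
  have hEm : MeasurableSet E := (hH.image continuous_fst).isClosed.measurableSet
  have hex : ∀ s ∈ E, ∃ s', (s, s') ∈ H := by
    rintro _ ⟨⟨s, s'⟩, h, rfl⟩
    exact ⟨s', h⟩
  choose! h hh using hex
  set k : ℝ → ℝ := fun s => if s ∈ E then h s else 0 with hk
  have hkE : ∀ s ∈ E, (s, k s) ∈ H := fun s hs => by
    simp only [hk, hs, if_true]; exact hh s hs
  have hinj : Set.InjOn k E := fun s₁ hs₁ s₂ hs₂ he =>
    h₂ (k s₁) s₁ s₂ (hkE s₁ hs₁) (by rw [he]; exact hkE s₂ hs₂)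
  have himg : k '' E = Prod.snd '' H := by
    ext s'
    constructor
    · rintro ⟨s, hs, rfl⟩
      exact ⟨_, hkE s hs, rfl⟩
    · rintro ⟨⟨s, s''⟩, hs, rfl⟩
      have hsE : s ∈ E := ⟨_, hs, rfl⟩
      exact ⟨s, hsE, h₁ s _ _ (hkE s hsE) hs⟩
  have hkm : Measurable k := by
    refine measurable_of_isClosed fun B hB => ?_
    have e : k ⁻¹' B = (Prod.fst '' (H ∩ Prod.snd ⁻¹' B)) ∪ (Eᶜ ∩ {_s | (0 : ℝ) ∈ B}) := by
      ext s
      by_cases hs : s ∈ E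
      · simp only [Set.mem_preimage, Set.mem_union, Set.mem_inter_iff, Set.mem_compl_iff, hs,
          not_true_eq_false, false_and, or_false]
        constructor
        · exact fun hB => ⟨(s, k s), ⟨hkE s hs, hB⟩, rfl⟩
        · rintro ⟨⟨s₁, s'⟩, ⟨hH', hB'⟩, rfl⟩
          rw [h₁ _ _ _ (hkE _ hs) hH']
          exact hB'
      · have h3 : s ∉ Prod.fst '' (H ∩ Prod.snd ⁻¹' B) := fun h4 =>
          hs (Set.image_mono Set.inter_subset_left h4)
        have h5 : k s = 0 := by simp [hk, hs]
        simp [h3, hs, h5]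
    rw [e]
    refine MeasurableSet.union ?_ (hEm.compl.inter (MeasurableSet.const _))
    exact ((hH.inter_right (hB.preimage continuous_snd)).image continuous_fst).isClosed.measurableSet
  have hmap : (α.restrict E).map k = β.restrict (Prod.snd '' H) := by
    ext B hB
    rw [Measure.map_apply hkm hB, Measure.restrict_apply (hkm hB), Measure.restrict_apply hB,
      hαβ _ k ((hkm hB).inter hEm) hkm (hinj.mono Set.inter_subset_right)
        (fun s hs => hkE s hs.2), ← himg, Set.inter_comm, Set.image_inter_preimage, Set.inter_comm]
  rw [← hmap, lintegral_map hg' hkm]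
  exact setLIntegral_congr_fun hEm fun s hs => hgg' s _ (hkE s hs)

namespace FlowBox

variable {Γ : Subgroup SOplus} {lam : GeodesicLamination Γ} (R S : FlowBox lam)

/-- The flow-box map, extended continuously to the plane, with the variables swapped. -/
def extF (z : ℝ × ℝ) : HypPlane :=
  R.F (Set.projIcc R.a R.b R.hab.le z.2, Set.projIcc R.c R.d R.hcd.le z.1)

lemma continuous_extF : Continuous R.extF := by
  refine R.continuousOn_F.comp_continuous ?_ fun z => ⟨Subtype.coe_prop _, Subtype.coe_prop _⟩
  exact (continuous_subtype_val.comp (continuous_projIcc.comp continuous_snd)).prodMk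
    (continuous_subtype_val.comp (continuous_projIcc.comp continuous_fst))

lemma extF_eq {t s : ℝ} (ht : t ∈ Set.Icc R.a R.b) (hs : s ∈ Set.Icc R.c R.d) :
    R.extF (s, t) = R.F (t, s) := by
  simp only [extF, Set.projIcc_of_mem _ ht, Set.projIcc_of_mem _ hs]

/-- The hyperbolic length of the derivative of `extF` along horizontal lines. -/
def extSpeed (z : ℝ × ℝ) : ℝ :=
  √(mink (deriv (fun τ => (R.extF (z.1, τ)).1) z.2) (deriv (fun τ => (R.extF (z.1, τ)).1) z.2))

lemma measurable_extSpeed : Measurable R.extSpeed := by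
  have h : Measurable fun z : ℝ × ℝ => deriv (fun τ => (R.extF (z.1, τ)).1) z.2 :=
    measurable_deriv_with_param (f := fun s τ => (R.extF (s, τ)).1)
      (continuous_subtype_val.comp R.continuous_extF)
  have hm : Continuous fun d : Fin 3 → ℝ => √(mink d d) := by
    unfold mink; fun_prop
  exact hm.measurable.comp h

lemma extSpeed_eq {t s : ℝ} (ht : t ∈ Set.Ioo R.a R.b) (hs : s ∈ Set.Icc R.c R.d) :
    R.extSpeed (s, t) = R.speed t s := by
  have : (fun τ => (R.extF (s, τ)).1) =ᶠ[nhds t] fun τ => (R.F (τ, s)).1 := by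
    filter_upwards [Icc_mem_nhds ht.1 ht.2] with τ hτ
    rw [R.extF_eq hτ hs]
  simp only [extSpeed, speed, dt, this.deriv_eq]

lemma C_subset_Icc : R.C ⊆ Set.Icc R.c R.d := R.C_subset.trans Set.Ioo_subset_Icc_self

lemma exists_speed_le : ∃ B : ℝ, ∀ t ∈ Set.Ioo R.a R.b, ∀ s ∈ Set.Icc R.c R.d,
    R.speed t s ≤ B := by
  obtain ⟨K, hK⟩ := R.exists_lipschitzOnWith
  refine ⟨√(2 * (K : ℝ) ^ 2), fun t ht s hs => Real.sqrt_le_sqrt ?_⟩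
  have hl : LipschitzOnWith K (fun τ => (R.F (τ, s)).1) (Set.Icc R.a R.b) := by
    refine LipschitzOnWith.of_dist_le_mul fun x hx y hy => ?_
    have := hK.dist_le_mul (x, s) ⟨hx, hs⟩ (y, s) ⟨hy, hs⟩
    rwa [Prod.dist_eq, dist_self, max_eq_left dist_nonneg] at this
  have h : ‖R.dt t s‖ ≤ K := norm_deriv_le_of_lipschitzOn (Icc_mem_nhds ht.1 ht.2) hl
  have hi : ∀ i, R.dt t s i ^ 2 ≤ (K : ℝ) ^ 2 := fun i => by
    rw [← sq_abs]
    exact pow_le_pow_left₀ (abs_nonneg _) ((norm_le_pi_norm (R.dt t s) i).trans h) 2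
  simp only [mink]
  nlinarith [hi 0, hi 1, sq_nonneg (R.dt t s 2)]

/-- The integral of a function on the surface over a horizontal segment, with respect to
arc length. -/
def plaqueIntegral (f : Surface Γ → ℝ≥0∞) (s : ℝ) : ℝ≥0∞ :=
  ∫⁻ t in Set.Ioo R.a R.b, ENNReal.ofReal (R.extSpeed (s, t)) * f (proj Γ (R.extF (s, t)))

lemma plaqueIntegral_eq (f : Surface Γ → ℝ≥0∞) {s : ℝ} (hs : s ∈ R.C) :
    R.plaqueIntegral f s =
      ∫⁻ t in Set.Ioo R.a R.b, ENNReal.ofReal (R.speed t s) * f (R.toSurface (t, s)) := by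
  refine setLIntegral_congr_fun measurableSet_Ioo fun t ht => ?_
  simp only [R.extSpeed_eq ht (R.C_subset_Icc hs), toSurface,
    R.extF_eq (Set.Ioo_subset_Icc_self ht) (R.C_subset_Icc hs)]

lemma measurable_integrand {f : Surface Γ → ℝ≥0∞} (hf : Measurable f) :
    Measurable fun z => ENNReal.ofReal (R.extSpeed z) * f (proj Γ (R.extF z)) :=
  R.measurable_extSpeed.ennreal_ofReal.mul
    (hf.comp (measurable_proj.comp R.continuous_extF.measurable))

lemma measurable_plaqueIntegral {f : Surface Γ → ℝ≥0∞} (hf : Measurable f) :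
    Measurable (R.plaqueIntegral f) :=
  (R.measurable_integrand hf).lintegral_prod_right'

/-- Arc length along a horizontal segment, in terms of a unit speed parametrization of the leaf. -/
lemma plaqueIntegral_eq_setLIntegral_geod (f : Surface Γ → ℝ≥0∞) {s : ℝ} (hs : s ∈ R.C)
    {x : HypPlane} {v : Fin 3 → ℝ} (hv : IsUnitTangent x v)
    (hℓ : ∀ t ∈ Set.Icc R.a R.b, R.F (t, s) ∈ Set.range (geod hv)) :
    R.plaqueIntegral f s =
      ∫⁻ τ in {τ | ∃ t ∈ Set.Icc R.a R.b, R.F (t, s) = geod hv τ}, f (proj Γ (geod hv τ)) := by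
  set σ : ℝ → ℝ := fun t => Real.arsinh (mink (R.F (t, s)).1 v) with hσ
  have hgσ : ∀ t ∈ Set.Icc R.a R.b, geod hv (σ t) = R.F (t, s) := by
    intro t ht
    obtain ⟨τ, hτ⟩ := hℓ t ht
    simp only [hσ, ← hτ, arsinh_mink_geod]
  obtain ⟨K, hK⟩ := R.exists_lipschitzOnWith
  have hσK : ∃ K' : NNReal, LipschitzOnWith K' σ (Set.Icc R.a R.b) := by
    let L : (Fin 3 → ℝ) →ₗ[ℝ] ℝ :=
      { toFun := fun y => mink y v
        map_add' := fun y z => mink_add_left y z v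
        map_smul' := fun c y => mink_smul_left c y v }
    have hL := (LinearMap.toContinuousLinearMap L).lipschitz
    have hl : LipschitzOnWith K (fun τ => (R.F (τ, s)).1) (Set.Icc R.a R.b) := by
      refine LipschitzOnWith.of_dist_le_mul fun y hy z hz => ?_
      have := hK.dist_le_mul (y, s) (R.mk_mem_rect hy hs) (z, s) (R.mk_mem_rect hz hs)
      rwa [Prod.dist_eq, dist_self, max_eq_left dist_nonneg] at this
    exact ⟨_, (lipschitzWith_arsinh.comp hL).comp_lipschitzOnWith hl⟩
  obtain ⟨K', hK'⟩ := hσK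
  have hinj : Set.InjOn σ (Set.Icc R.a R.b) := by
    intro t ht t' ht' he
    have h1 : R.F (t, s) = R.F (t', s) := by rw [← hgσ t ht, ← hgσ t' ht', he]
    have := R.injective (R.mk_mem_rect ht hs) (R.mk_mem_rect ht' hs) (congrArg (proj Γ) h1)
    exact congrArg Prod.fst this
  set D := Set.Ioo R.a R.b ∩ {t | DifferentiableAt ℝ σ t} with hD
  have hDm : MeasurableSet D := measurableSet_Ioo.inter (measurableSet_of_differentiableAt ℝ σ)
  have hDI : D ⊆ Set.Icc R.a R.b := Set.inter_subset_left.trans Set.Ioo_subset_Icc_self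
  have hae : ∀ᵐ t : ℝ, t ∈ Set.Ioo R.a R.b → DifferentiableAt ℝ σ t := by
    filter_upwards [hK'.ae_differentiableWithinAt_of_mem] with t ht htI
    exact (ht (Set.Ioo_subset_Icc_self htI)).differentiableAt (Icc_mem_nhds htI.1 htI.2)
  have hDae : D =ᵐ[volume] Set.Ioo R.a R.b := by
    filter_upwards [hae] with t ht
    exact propext ⟨fun h => h.1, fun h => ⟨h, ht h⟩⟩
  have hDae' : D =ᵐ[volume] Set.Icc R.a R.b := hDae.trans Ioo_ae_eq_Icc
  have hnull : volume (σ '' (Set.Icc R.a R.b \ D)) = 0 :=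
    hK'.volume_image_eq_zero Set.sdiff_subset (ae_le_set.1 hDae'.symm.le)
  have hT : {τ | ∃ t ∈ Set.Icc R.a R.b, R.F (t, s) = geod hv τ} = σ '' Set.Icc R.a R.b := by
    ext τ
    constructor
    · rintro ⟨t, ht, he⟩
      exact ⟨t, ht, by simp only [hσ, he, arsinh_mink_geod]⟩
    · rintro ⟨t, ht, rfl⟩
      exact ⟨t, ht, (hgσ t ht).symm⟩
  have hTae : σ '' D =ᵐ[volume] σ '' Set.Icc R.a R.b := by
    refine (Filter.EventuallyLE.antisymm (Set.image_mono hDI).eventuallyLE ?_)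
    rw [ae_le_set]
    refine measure_mono_null ?_ hnull
    rintro _ ⟨⟨t, ht, rfl⟩, h2⟩
    exact ⟨t, ⟨ht, fun h => h2 ⟨t, h, rfl⟩⟩, rfl⟩
  have hspeed : ∀ t ∈ D, R.speed t s = |deriv σ t| := by
    rintro t ⟨htI, htd⟩
    have hd : HasDerivAt σ (deriv σ t) t := DifferentiableAt.hasDerivAt htd
    have h1 : HasDerivAt (fun τ => Real.cosh (σ τ) • x.1 + Real.sinh (σ τ) • v)
        ((Real.sinh (σ t) * deriv σ t) • x.1 + (Real.cosh (σ t) * deriv σ t) • v) t :=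
      (hd.cosh.smul_const x.1).add (hd.sinh.smul_const v)
    have h2 : (fun τ => (R.F (τ, s)).1) =ᶠ[nhds t]
        fun τ => Real.cosh (σ τ) • x.1 + Real.sinh (σ τ) • v := by
      filter_upwards [Icc_mem_nhds htI.1 htI.2] with τ hτ
      rw [← hgσ τ hτ, coe_geod]
    have h3 : R.dt t s = _ := h2.deriv_eq.trans h1.deriv
    rw [speed, h3, ← Real.sqrt_sq_eq_abs]
    congr 1
    simp only [mink_add_left, mink_add_right, mink_smul_left, mink_smul_right, hv.2, hv.1, x.2.1,
      mink_comm x.1 v]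
    have := Real.cosh_sq (σ t)
    linear_combination (deriv σ t) ^ 2 * this
  rw [R.plaqueIntegral_eq f hs, hT, ← setLIntegral_congr hTae, ← setLIntegral_congr hDae,
    lintegral_image_eq_lintegral_abs_deriv_mul hDm
      (fun t ht => (DifferentiableAt.hasDerivAt ht.2).hasDerivWithinAt) (hinj.mono hDI)]
  refine setLIntegral_congr_fun hDm fun t ht => ?_
  simp only [hspeed t ht, hgσ t (hDI ht), toSurface]

end FlowBox

lemma IsUnitTangent.smul {Γ : Subgroup SOplus} (γ : Γ) {x : HypPlane} {v : Fin 3 → ℝ}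
    (hv : IsUnitTangent x v) : IsUnitTangent (γ • x) (matOf γ.1 *ᵥ v) := by
  refine ⟨?_, ?_⟩
  · rw [coe_smul_hypPlane]; exact (γ.1.2.1 v x.1).trans hv.1
  · exact (γ.1.2.1 v v).trans hv.2

namespace FlowBox

variable {Γ : Subgroup SOplus} {lam : GeodesicLamination Γ} (R S : FlowBox lam)

/-- The pairs of heights of horizontal segments of two flow-boxes that meet in a point of `Z`. -/
def holonomy (Z : Set (Surface Γ)) : Set (ℝ × ℝ) :=
  {z | z.1 ∈ R.C ∧ z.2 ∈ S.C ∧ ∃ t ∈ Set.Icc R.a R.b, ∃ t' ∈ Set.Icc S.a S.b,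
    R.toSurface (t, z.1) = S.toSurface (t', z.2) ∧ R.toSurface (t, z.1) ∈ Z}

lemma swap_mem_holonomy {Z : Set (Surface Γ)} {s s' : ℝ} (h : (s, s') ∈ R.holonomy S Z) :
    (s', s) ∈ S.holonomy R Z := by
  obtain ⟨h1, h2, t, ht, t', ht', he, hZ⟩ := h
  exact ⟨h2, h1, t', ht', t, ht, he.symm, by rwa [← he]⟩

lemma isCompact_holonomy (hΓ : IsClosedSurfaceGroup Γ) {Z : Set (Surface Γ)} (hZ : IsClosed Z) :
    IsCompact (R.holonomy S Z) := by
  have := hΓ.t2Space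
  set K : Set ((ℝ × ℝ) × (ℝ × ℝ)) :=
    (Set.Icc R.a R.b ×ˢ R.C) ×ˢ (Set.Icc S.a S.b ×ˢ S.C) with hK
  have hKc : IsCompact K :=
    (isCompact_Icc.prod R.isCompact_C).prod (isCompact_Icc.prod S.isCompact_C)
  have hc : ContinuousOn (fun q : (ℝ × ℝ) × (ℝ × ℝ) => (R.toSurface q.1, S.toSurface q.2)) K := by
    refine ContinuousOn.prodMk ?_ ?_
    · exact R.continuousOn_toSurface.comp continuousOn_fst
        fun q hq => R.mk_mem_rect hq.1.1 hq.1.2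
    · exact S.continuousOn_toSurface.comp continuousOn_snd
        fun q hq => S.mk_mem_rect hq.2.1 hq.2.2
  have hcl : IsClosed {w : Surface Γ × Surface Γ | w.1 = w.2 ∧ w.1 ∈ Z} :=
    (isClosed_eq continuous_fst continuous_snd).inter (hZ.preimage continuous_fst)
  have hcomp := hKc.of_isClosed_subset (hc.preimage_isClosed_of_isClosed hKc.isClosed hcl)
    Set.inter_subset_left
  have himg := hcomp.image (f := fun q : (ℝ × ℝ) × (ℝ × ℝ) => (q.1.2, q.2.2)) (by fun_prop)
  convert himg using 1
  ext ⟨s, s'⟩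
  constructor
  · rintro ⟨h1, h2, t, ht, t', ht', he, hZ'⟩
    exact ⟨((t, s), (t', s')), ⟨⟨⟨ht, h1⟩, ⟨ht', h2⟩⟩, he, hZ'⟩, rfl⟩
  · rintro ⟨⟨⟨t, u⟩, ⟨t', u'⟩⟩, ⟨⟨⟨ht, h1⟩, ⟨ht', h2⟩⟩, he, hZ'⟩, h⟩
    cases h
    exact ⟨h1, h2, t, ht, t', ht', he, hZ'⟩

/-- Near a point in the interior of two flow-boxes, a fixed deck transformation relates the lifts
and the holonomy is one-to-one. -/
lemma exists_nhds_holonomy (hΓ : IsClosedSurfaceGroup Γ) {p : Surface Γ}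
    (hp : p ∈ interior R.image ∩ interior S.image) :
    ∃ Z ∈ nhds p, IsClosed Z ∧ Z ⊆ R.image ∩ S.image ∧
      (∃ γ : Γ, ∀ q ∈ R.rect, ∀ q' ∈ S.rect, R.toSurface q = S.toSurface q' →
        R.toSurface q ∈ Z → R.F q = γ • S.F q') ∧
      (∀ s s₁ s₂, (s, s₁) ∈ R.holonomy S Z → (s, s₂) ∈ R.holonomy S Z → s₁ = s₂) ∧
      (∀ s s₁ s₂, (s₁, s) ∈ R.holonomy S Z → (s₂, s) ∈ R.holonomy S Z → s₁ = s₂) := by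
  have := hΓ.t2Space
  have := hΓ.cocompact
  set W := interior R.image ∩ interior S.image with hW
  have hWo : IsOpen W := isOpen_interior.inter isOpen_interior
  obtain ⟨q₀, hq₀, hq₀p⟩ := interior_subset hp.1
  obtain ⟨q₀', hq₀', hq₀p'⟩ := interior_subset hp.2
  change R.toSurface q₀ = p at hq₀p
  change S.toSurface q₀' = p at hq₀p'
  obtain ⟨γ, hγ⟩ := proj_eq_proj_iff.1 (hq₀p.trans hq₀p'.symm)
  have hWx : proj Γ ⁻¹' W ∈ nhds (R.F q₀) :=
    (hWo.preimage continuous_proj).mem_nhds (by change R.toSurface q₀ ∈ W; rwa [hq₀p])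
  have hWx' : proj Γ ⁻¹' W ∈ nhds (S.F q₀') :=
    (hWo.preimage continuous_proj).mem_nhds (by change S.toSurface q₀' ∈ W; rwa [hq₀p'])
  obtain ⟨V₁, hV₁, hinj⟩ := hΓ.exists_nhds_injOn_proj (R.F q₀)
  obtain ⟨V, hV, hVs, hVc⟩ := exists_geodConvex_nhds (Filter.inter_mem hV₁ hWx)
  have hV₁' : (fun y : HypPlane => γ • y) ⁻¹' V₁ ∈ nhds (S.F q₀') :=
    (continuous_const_smul γ).continuousAt (by rw [hγ]; exact hV₁)
  obtain ⟨V', hV', hVs', hVc'⟩ := exists_geodConvex_nhds (Filter.inter_mem hV₁' hWx')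
  obtain ⟨U, hU, hUV⟩ := R.exists_nhds_forall_mem hΓ hq₀ hV
  obtain ⟨U', hU', hUV'⟩ := S.exists_nhds_forall_mem hΓ hq₀' hV'
  rw [hq₀p] at hU
  rw [hq₀p'] at hU'
  obtain ⟨Z, hZ, hZc, hZs⟩ := exists_mem_nhds_isClosed_subset
    (Filter.inter_mem (Filter.inter_mem hU hU') (hWo.mem_nhds hp))
  refine ⟨Z, hZ, hZc, fun z hz => ⟨interior_subset (hZs hz).2.1, interior_subset (hZs hz).2.2⟩,
    ⟨γ, fun q hq q' hq' he hqZ => ?_⟩, ?_, ?_⟩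
  · have h1 := hUV q hq (hZs hqZ).1.1
    have h2 := hUV' q' hq' (hZs (he ▸ hqZ)).1.2
    exact hinj (hVs h1).1 (hVs' h2).1 (he.trans (proj_smul γ _).symm)
  · rintro s s₁ s₂ ⟨hs, hs₁, t₁, ht₁, t₁', ht₁', he₁, hZ₁⟩ ⟨-, hs₂, t₂, ht₂, t₂', ht₂', he₂, hZ₂⟩
    obtain ⟨ℓ, hℓ, hFℓ⟩ := R.horizontal s hs
    exact S.snd_eq_of_geodConvex hΓ hVc (fun y hy => interior_subset (hVs hy).2.2) hℓ
      (hUV _ (R.mk_mem_rect ht₁ hs) (hZs hZ₁).1.1) (hUV _ (R.mk_mem_rect ht₂ hs) (hZs hZ₂).1.1)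
      (hFℓ t₁ ht₁) (hFℓ t₂ ht₂) (S.mk_mem_rect ht₁' hs₁) (S.mk_mem_rect ht₂' hs₂) he₁.symm he₂.symm
  · rintro s s₁ s₂ ⟨hs₁, hs, t₁, ht₁, t₁', ht₁', he₁, hZ₁⟩ ⟨hs₂, -, t₂, ht₂, t₂', ht₂', he₂, hZ₂⟩
    obtain ⟨ℓ, hℓ, hFℓ⟩ := S.horizontal s hs
    exact R.snd_eq_of_geodConvex hΓ hVc' (fun y hy => interior_subset (hVs' hy).2.1) hℓ
      (hUV' _ (S.mk_mem_rect ht₁' hs) (hZs (he₁ ▸ hZ₁)).1.2)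
      (hUV' _ (S.mk_mem_rect ht₂' hs) (hZs (he₂ ▸ hZ₂)).1.2)
      (hFℓ t₁' ht₁') (hFℓ t₂' ht₂') (R.mk_mem_rect ht₁ hs₁) (R.mk_mem_rect ht₂ hs₂) he₁ he₂

/-- A horizontal segment that meets `Z` has a partner in the other flow-box. -/
lemma exists_mem_holonomy {Z : Set (Surface Γ)} (hZ : Z ⊆ S.image) {t s : ℝ}
    (ht : t ∈ Set.Icc R.a R.b) (hs : s ∈ R.C) (h : R.toSurface (t, s) ∈ Z) :
    ∃ t' ∈ Set.Icc S.a S.b, ∃ s', (s, s') ∈ R.holonomy S Z ∧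
      R.toSurface (t, s) = S.toSurface (t', s') := by
  obtain ⟨⟨t', s'⟩, hq', he⟩ := hZ h
  change S.toSurface (t', s') = _ at he
  have hs' : s' ∈ S.C := by
    refine (S.preimage _ hq').1 ?_
    change S.toSurface (t', s') ∈ _
    rw [he]
    exact R.mem_carrier ht hs
  exact ⟨t', hq'.1, s', ⟨hs, hs', t, ht, t', hq'.1, he.symm, h⟩, he.symm⟩

lemma setLIntegral_plaqueIntegral_indicator {Z A : Set (Surface Γ)} (hZ : Z ⊆ S.image)
    (hA : A ⊆ Z) {H : Set ℝ} (hHm : MeasurableSet H) (hHC : H ⊆ R.C)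
    (hH : ∀ s s', (s, s') ∈ R.holonomy S Z → s ∈ H) (α : Measure ℝ) :
    ∫⁻ s in R.C, R.plaqueIntegral (A.indicator 1) s ∂α =
      ∫⁻ s in H, R.plaqueIntegral (A.indicator 1) s ∂α := by
  rw [← Set.inter_eq_self_of_subset_left hHC, ← setLIntegral_indicator hHm]
  refine setLIntegral_congr_fun R.closed_C.measurableSet fun s hs => ?_
  by_cases hsH : s ∈ H
  · rw [Set.indicator_of_mem hsH]
  · rw [Set.indicator_of_notMem hsH, R.plaqueIntegral_eq _ hs, setLIntegral_eq_zero measurableSet_Ioo]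
    intro t ht
    have : R.toSurface (t, s) ∉ A := fun h => by
      obtain ⟨t', -, s', h', -⟩ := R.exists_mem_holonomy S hZ (Set.Ioo_subset_Icc_self ht) hs (hA h)
      exact hsH (hH s s' h')
    simp [this]

/-- Related horizontal segments have the same part in `A`. -/
lemma plaqueIntegral_indicator_eq {Z A : Set (Surface Γ)} (hZ : Z ⊆ R.image ∩ S.image)
    (hA : A ⊆ Z) {γ : Γ}
    (hγ : ∀ q ∈ R.rect, ∀ q' ∈ S.rect, R.toSurface q = S.toSurface q' →
        R.toSurface q ∈ Z → R.F q = γ • S.F q')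
    (h₁ : ∀ s s₁ s₂, (s, s₁) ∈ R.holonomy S Z → (s, s₂) ∈ R.holonomy S Z → s₁ = s₂)
    (h₂ : ∀ s s₁ s₂, (s₁, s) ∈ R.holonomy S Z → (s₂, s) ∈ R.holonomy S Z → s₁ = s₂)
    {s s' : ℝ} (h : (s, s') ∈ R.holonomy S Z) :
    R.plaqueIntegral (A.indicator 1) s = S.plaqueIntegral (A.indicator 1) s' := by
  have hhol := h
  obtain ⟨hs, hs', t₀, ht₀, t₀', ht₀', he, hZ₀⟩ := h
  have hF₀ := hγ _ (R.mk_mem_rect ht₀ hs) _ (S.mk_mem_rect ht₀' hs') he hZ₀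
  obtain ⟨ℓ, hℓ, hRℓ⟩ := R.horizontal s hs
  obtain ⟨ℓ', hℓ', hSℓ⟩ := S.horizontal s' hs'
  have hℓℓ : (fun y => γ • y) '' ℓ' = ℓ := by
    by_contra hne
    refine Set.disjoint_left.1 (lam.disjoint (lam.invariant γ ℓ' hℓ') hℓ hne)
      ⟨_, hSℓ t₀' ht₀', rfl⟩ ?_
    simp only [id, ← hF₀]
    exact hRℓ t₀ ht₀
  obtain ⟨x, v, hv, rfl⟩ := (lam.geodesic ℓ' hℓ').exists_eq_range
  have hv' := hv.smul γ
  have hgeod : ∀ τ, geod hv' τ = γ • geod hv τ := by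
    intro τ
    apply Subtype.ext
    rw [coe_smul_hypPlane, coe_geod, coe_geod, Matrix.mulVec_add, Matrix.mulVec_smul,
      Matrix.mulVec_smul, coe_smul_hypPlane]
  have hR' : ∀ t ∈ Set.Icc R.a R.b, R.F (t, s) ∈ Set.range (geod hv') := by
    intro t ht
    have h := hRℓ t ht
    rw [← hℓℓ] at h
    obtain ⟨_, ⟨τ, rfl⟩, hτ⟩ := h
    exact ⟨τ, (hgeod τ).trans hτ⟩
  have hmR : MeasurableSet {τ | ∃ t ∈ Set.Icc R.a R.b, R.F (t, s) = geod hv' τ} := by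
    have h1 : IsCompact ((fun t => R.F (t, s)) '' Set.Icc R.a R.b) :=
      isCompact_Icc.image_of_continuousOn
        (R.continuousOn_F.comp (by fun_prop) fun t ht => R.mk_mem_rect ht hs)
    exact (h1.isClosed.preimage (continuous_geod hv')).measurableSet
  have hmS : MeasurableSet {τ | ∃ t ∈ Set.Icc S.a S.b, S.F (t, s') = geod hv τ} := by
    have h1 : IsCompact ((fun t => S.F (t, s')) '' Set.Icc S.a S.b) :=
      isCompact_Icc.image_of_continuousOn
        (S.continuousOn_F.comp (by fun_prop) fun t ht => S.mk_mem_rect ht hs')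
    exact (h1.isClosed.preimage (continuous_geod hv)).measurableSet
  rw [R.plaqueIntegral_eq_setLIntegral_geod _ hs hv' hR',
    S.plaqueIntegral_eq_setLIntegral_geod _ hs' hv hSℓ, ← lintegral_indicator hmR,
    ← lintegral_indicator hmS]
  refine lintegral_congr fun τ => ?_
  have hproj : proj Γ (geod hv' τ) = proj Γ (geod hv τ) := by rw [hgeod, proj_smul]
  by_cases hτA : proj Γ (geod hv τ) ∈ A
  · have hiff : (∃ t ∈ Set.Icc R.a R.b, R.F (t, s) = geod hv' τ) ↔
        ∃ t ∈ Set.Icc S.a S.b, S.F (t, s') = geod hv τ := by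
      constructor
      · rintro ⟨t, ht, hte⟩
        have hp : R.toSurface (t, s) = proj Γ (geod hv τ) := by rw [toSurface, hte, hproj]
        have hZt : R.toSurface (t, s) ∈ Z := hp ▸ hA hτA
        obtain ⟨t', ht', s'', hh, hee⟩ :=
          R.exists_mem_holonomy S (hZ.trans Set.inter_subset_right) ht hs hZt
        obtain rfl := h₁ _ _ _ hhol hh
        refine ⟨t', ht', ?_⟩
        have := hγ _ (R.mk_mem_rect ht hs) _ (S.mk_mem_rect ht' hs') hee hZt
        rw [hte, hgeod] at this
        exact (smul_left_cancel γ this).symm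
      · rintro ⟨t', ht', hte⟩
        have hp : S.toSurface (t', s') = proj Γ (geod hv τ) := by rw [toSurface, hte]
        have hZt : S.toSurface (t', s') ∈ Z := hp ▸ hA hτA
        obtain ⟨t, ht, s'', hh, hee⟩ :=
          S.exists_mem_holonomy R (hZ.trans Set.inter_subset_left) ht' hs' hZt
        obtain rfl := h₂ _ _ _ hhol (S.swap_mem_holonomy R hh)
        refine ⟨t, ht, ?_⟩
        rw [hγ _ (R.mk_mem_rect ht hs) _ (S.mk_mem_rect ht' hs') hee.symm (hee ▸ hZt), hte, hgeod]
    have hmem : τ ∈ {τ | ∃ t ∈ Set.Icc R.a R.b, R.F (t, s) = geod hv' τ} ↔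
        τ ∈ {τ | ∃ t ∈ Set.Icc S.a S.b, S.F (t, s') = geod hv τ} := hiff
    by_cases hτ : τ ∈ {τ | ∃ t ∈ Set.Icc S.a S.b, S.F (t, s') = geod hv τ}
    · rw [Set.indicator_of_mem (hmem.2 hτ), Set.indicator_of_mem hτ, hproj]
    · rw [Set.indicator_of_notMem (mt hmem.1 hτ), Set.indicator_of_notMem hτ]
  · simp only [Set.indicator, hproj, hτA, if_false, ite_self]

variable (μ : TransverseMeasure lam)

/-- The measure on the surface obtained by integrating the arc length of the horizontal segments
of a flow-box against the transverse measure. -/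
def lengthMeasure : Measure (Surface Γ) :=
  ((((μ.measure R).restrict R.C).prod (volume.restrict (Set.Ioo R.a R.b))).withDensity
    fun z => ENNReal.ofReal (R.extSpeed z)).map fun z => proj Γ (R.extF z)

lemma lintegral_lengthMeasure {f : Surface Γ → ℝ≥0∞} (hf : Measurable f) :
    ∫⁻ x, f x ∂(R.lengthMeasure μ) = ∫⁻ s in R.C, R.plaqueIntegral f s ∂(μ.measure R) := by
  have := μ.finite R
  have hm : Measurable fun z => proj Γ (R.extF z) :=
    measurable_proj.comp R.continuous_extF.measurable
  rw [lengthMeasure, lintegral_map hf hm]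
  refine (lintegral_withDensity_eq_lintegral_mul _ R.measurable_extSpeed.ennreal_ofReal
    (hf.comp hm)).trans ?_
  exact lintegral_prod _ (R.measurable_integrand hf).aemeasurable

lemma lintegral_lengthMeasure_congr {f g : Surface Γ → ℝ≥0∞} (hf : Measurable f)
    (hg : Measurable g) (h : ∀ x ∈ lam.carrier, f x = g x) :
    ∫⁻ x, f x ∂(R.lengthMeasure μ) = ∫⁻ x, g x ∂(R.lengthMeasure μ) := by
  rw [R.lintegral_lengthMeasure μ hf, R.lintegral_lengthMeasure μ hg]
  refine setLIntegral_congr_fun R.closed_C.measurableSet fun s hs => ?_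
  simp only [R.plaqueIntegral_eq _ hs]
  refine setLIntegral_congr_fun measurableSet_Ioo fun t ht => ?_
  simp only [h _ (R.mem_carrier (Set.Ioo_subset_Icc_self ht) hs)]

lemma exists_nhds_lengthMeasure_restrict_eq (hΓ : IsClosedSurfaceGroup Γ) {p : Surface Γ}
    (hp : p ∈ interior R.image ∩ interior S.image) :
    ∃ Z ∈ nhds p, (R.lengthMeasure μ).restrict Z = (S.lengthMeasure μ).restrict Z := by
  obtain ⟨Z, hZp, hZc, hZ, ⟨γ, hγ⟩, h₁, h₂⟩ := R.exists_nhds_holonomy S hΓ hp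
  refine ⟨Z, hZp, ?_⟩
  have hH := R.isCompact_holonomy S hΓ hZc
  have key : ∀ A, MeasurableSet A → A ⊆ Z → R.lengthMeasure μ A = S.lengthMeasure μ A := by
    intro A hA hAZ
    have hm : Measurable (A.indicator (1 : Surface Γ → ℝ≥0∞)) := measurable_one.indicator hA
    rw [← lintegral_indicator_one hA, ← lintegral_indicator_one hA, R.lintegral_lengthMeasure μ hm,
      S.lintegral_lengthMeasure μ hm,
      R.setLIntegral_plaqueIntegral_indicator S (hZ.trans Set.inter_subset_right) hAZ
        (hH.image continuous_fst).isClosed.measurableSet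
        (by rintro _ ⟨z, hz, rfl⟩; exact hz.1) (fun s s' h => ⟨(s, s'), h, rfl⟩),
      S.setLIntegral_plaqueIntegral_indicator R (hZ.trans Set.inter_subset_left) hAZ
        (hH.image continuous_snd).isClosed.measurableSet
        (by rintro _ ⟨z, hz, rfl⟩; exact hz.2.1)
        (fun s s' h => ⟨(s', s), S.swap_mem_holonomy R h, rfl⟩)]
    refine setLIntegral_fst_image_eq_snd_image hH h₁ h₂ ?_ (S.measurable_plaqueIntegral hm)
      fun s s' h => R.plaqueIntegral_indicator_eq S hZ hAZ hγ h₁ h₂ h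
    intro E h hE hh hinj hEH
    refine μ.compatible R S E h hE (fun s hs => (hEH s hs).1) hh hinj fun s hs => ?_
    obtain ⟨-, h2, t, ht, t', ht', he, -⟩ := hEH s hs
    exact ⟨h2, t, ht, t', ht', he⟩
  ext A hA
  rw [Measure.restrict_apply hA, Measure.restrict_apply hA]
  exact key _ (hA.inter hZc.measurableSet) Set.inter_subset_right

/-- The length measures of two flow-boxes agree where both are defined. -/
lemma lengthMeasure_restrict_eq (hΓ : IsClosedSurfaceGroup Γ) :
    (R.lengthMeasure μ).restrict (interior R.image ∩ interior S.image) =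
      (S.lengthMeasure μ).restrict (interior R.image ∩ interior S.image) := by
  have : SecondCountableTopology (Surface Γ) := ContinuousConstSMul.secondCountableTopology
  choose! Z hZ hZeq using fun p hp => R.exists_nhds_lengthMeasure_restrict_eq S μ hΓ (p := p) hp
  obtain ⟨T, hTs, hTc, hT⟩ := TopologicalSpace.countable_cover_nhdsWithin
    (fun p hp => mem_nhdsWithin_of_mem_nhds (hZ p hp))
  exact Measure.restrict_congr_mono hT
    ((Measure.restrict_biUnion_congr hTc).2 fun p hp => hZeq p (hTs hp))

end FlowBox

namespace FlowBox

variable {Γ : Subgroup SOplus} {lam : GeodesicLamination Γ} (R : FlowBox lam)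
  (μ : TransverseMeasure lam)

lemma ae_mem_C : ∀ᵐ s ∂μ.measure R, s ∈ R.C := μ.support R

section
variable {ψ : Surface Γ → ℝ} (hψ : Measurable ψ) (hψ0 : ∀ x, 0 ≤ ψ x)
  (hψ1 : ∀ x ∈ lam.carrier, ψ x ≤ 1)

include hψ hψ0 hψ1 in
lemma integrableOn_mul_speed {s : ℝ} (hs : s ∈ R.C) :
    IntegrableOn (fun t => ψ (proj Γ (R.F (t, s))) * R.speed t s) (Set.Ioo R.a R.b) := by
  obtain ⟨B, hB⟩ := R.exists_speed_le
  have hm : Measurable fun t => ψ (proj Γ (R.extF (s, t))) * R.extSpeed (s, t) :=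
    ((hψ.comp (measurable_proj.comp R.continuous_extF.measurable)).mul
      R.measurable_extSpeed).comp measurable_prodMk_left
  refine Integrable.of_bound (hm.aestronglyMeasurable.congr ?_) B ?_
  · filter_upwards [ae_restrict_mem measurableSet_Ioo] with t ht
    rw [R.extF_eq (Set.Ioo_subset_Icc_self ht) (R.C_subset_Icc hs),
      R.extSpeed_eq ht (R.C_subset_Icc hs)]
  · filter_upwards [ae_restrict_mem measurableSet_Ioo] with t ht
    rw [Real.norm_of_nonneg (mul_nonneg (hψ0 _) (R.speed_nonneg _ _))]
    refine (mul_le_of_le_one_left (R.speed_nonneg _ _) (hψ1 _ ?_)).trans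
      (hB t ht s (R.C_subset_Icc hs))
    exact R.mem_carrier (Set.Ioo_subset_Icc_self ht) hs

include hψ hψ0 hψ1 in
lemma integral_mul_speed {s : ℝ} (hs : s ∈ R.C) :
    ∫ t in Set.Icc R.a R.b, ψ (proj Γ (R.F (t, s))) * R.speed t s =
      (R.plaqueIntegral (fun x => ENNReal.ofReal (ψ x)) s).toReal := by
  have hi := R.integrableOn_mul_speed hψ hψ0 hψ1 hs
  rw [integral_Icc_eq_integral_Ioo, integral_eq_lintegral_of_nonneg_ae
    (Filter.Eventually.of_forall fun t => mul_nonneg (hψ0 _) (R.speed_nonneg _ _))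
    hi.aestronglyMeasurable, R.plaqueIntegral_eq _ hs]
  congr 2
  ext t
  rw [mul_comm, ENNReal.ofReal_mul (R.speed_nonneg _ _), toSurface]

include hψ1 in
lemma exists_plaqueIntegral_le : ∃ B : ℝ, ∀ s ∈ R.C,
    R.plaqueIntegral (fun x => ENNReal.ofReal (ψ x)) s ≤ ENNReal.ofReal B := by
  obtain ⟨B, hB⟩ := R.exists_speed_le
  refine ⟨B * (R.b - R.a), fun s hs => ?_⟩
  rw [R.plaqueIntegral_eq _ hs, ENNReal.ofReal_mul' (sub_nonneg.2 R.hab.le), ← Real.volume_Ioo,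
    ← setLIntegral_const]
  refine setLIntegral_mono' measurableSet_Ioo fun t ht => ?_
  have h1 : ENNReal.ofReal (ψ (R.toSurface (t, s))) ≤ 1 :=
    ENNReal.ofReal_le_one.2 (hψ1 _ (R.mem_carrier (Set.Ioo_subset_Icc_self ht) hs))
  calc _ ≤ ENNReal.ofReal (R.speed t s) * 1 := by gcongr
    _ ≤ _ := by
      rw [mul_one]
      exact ENNReal.ofReal_le_ofReal (hB t ht s (R.C_subset_Icc hs))

lemma restrict_Icc_eq_restrict_C :
    (μ.measure R).restrict (Set.Icc R.c R.d) = (μ.measure R).restrict R.C := by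
  rw [Measure.restrict_eq_self_of_ae_mem (R.ae_mem_C μ),
    Measure.restrict_eq_self_of_ae_mem ((R.ae_mem_C μ).mono fun s hs => R.C_subset_Icc hs)]

include hψ hψ1 in
lemma lintegral_ofReal_lengthMeasure_lt_top :
    ∫⁻ x, ENNReal.ofReal (ψ x) ∂(R.lengthMeasure μ) < ⊤ := by
  have := μ.finite R
  obtain ⟨B, hB⟩ := R.exists_plaqueIntegral_le hψ1
  rw [R.lintegral_lengthMeasure μ hψ.ennreal_ofReal]
  refine (setLIntegral_mono' R.closed_C.measurableSet hB).trans_lt ?_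
  rw [setLIntegral_const]
  exact ENNReal.mul_lt_top ENNReal.ofReal_lt_top (measure_lt_top _ _)

include hψ hψ0 hψ1 in
lemma integral_integral_mul_speed :
    ∫ s in Set.Icc R.c R.d, (∫ t in Set.Icc R.a R.b, ψ (proj Γ (R.F (t, s))) * R.speed t s)
      ∂(μ.measure R) = (∫⁻ x, ENNReal.ofReal (ψ x) ∂(R.lengthMeasure μ)).toReal := by
  obtain ⟨B, hB⟩ := R.exists_plaqueIntegral_le hψ1
  rw [R.restrict_Icc_eq_restrict_C μ, R.lintegral_lengthMeasure μ hψ.ennreal_ofReal,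
    setIntegral_congr_fun R.closed_C.measurableSet
      (fun s hs => R.integral_mul_speed hψ hψ0 hψ1 hs)]
  refine integral_toReal (R.measurable_plaqueIntegral hψ.ennreal_ofReal).aemeasurable ?_
  filter_upwards [ae_restrict_mem R.closed_C.measurableSet] with s hs
  exact (hB s hs).trans_lt ENNReal.ofReal_lt_top

include hψ hψ0 hψ1 in
lemma integrableOn_integral_mul_speed :
    IntegrableOn (fun s => ∫ t in Set.Icc R.a R.b, ψ (proj Γ (R.F (t, s))) * R.speed t s)
      (Set.Icc R.c R.d) (μ.measure R) := by
  have h := R.lintegral_ofReal_lengthMeasure_lt_top μ hψ hψ1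
  rw [R.lintegral_lengthMeasure μ hψ.ennreal_ofReal] at h
  rw [IntegrableOn, R.restrict_Icc_eq_restrict_C μ]
  refine (integrable_toReal_of_lintegral_ne_top
    (R.measurable_plaqueIntegral hψ.ennreal_ofReal).aemeasurable h.ne).congr ?_
  filter_upwards [ae_restrict_mem R.closed_C.measurableSet] with s hs
  exact (R.integral_mul_speed hψ hψ0 hψ1 hs).symm

end

end FlowBox

namespace FlowBoxPartition

variable {Γ : Subgroup SOplus} {lam : GeodesicLamination Γ} (P Q : FlowBoxPartition lam)
  (μ : TransverseMeasure lam)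

lemma measurable_ψ (i : Fin P.n) : Measurable (P.ψ i) := by
  set U := ⋃ j, interior (P.box j).image with hU
  have hUo : IsOpen U := isOpen_iUnion fun _ => isOpen_interior
  set π : HypPlane → ℝ × ℝ := fun x => (x.1 0, x.1 1) with hπ
  have hπc : Continuous π :=
    ((continuous_apply 0).comp continuous_subtype_val).prodMk
      ((continuous_apply 1).comp continuous_subtype_val)
  have hchart : ∀ x, chart (π x) = x := by
    intro x
    have h1 := x.2.1
    simp only [mink] at h1
    have h2 : √(1 + x.1 0 ^ 2 + x.1 1 ^ 2) = x.1 2 := by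
      rw [Real.sqrt_eq_iff_mul_self_eq_of_pos (by linarith [x.2.2])]
      linarith
    apply Subtype.ext
    ext k
    fin_cases k
    · rfl
    · rfl
    · exact h2
  have hV : IsOpen (proj Γ ⁻¹' U) := hUo.preimage continuous_proj
  have hc : ContinuousOn (fun x => P.ψ i (proj Γ x)) (proj Γ ⁻¹' U) := by
    have h1 := (P.smooth i).continuousOn.comp (s := proj Γ ⁻¹' U) hπc.continuousOn
      (fun x hx => by
        change proj Γ (chart (π x)) ∈ U
        rwa [hchart])
    refine h1.congr fun x hx => ?_
    simp only [Function.comp, hchart]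
  refine measurable_from_quotient.2 ?_
  change Measurable fun x => P.ψ i (proj Γ x)
  refine measurable_of_restrict_of_restrict_compl hV.measurableSet hc.domRestrict.measurable ?_
  have h0 : (proj Γ ⁻¹' U)ᶜ.domRestrict (fun x => P.ψ i (proj Γ x)) = fun _ => 0 := by
    ext ⟨x, hx⟩
    by_contra hne
    exact hx (Set.mem_iUnion.2 ⟨i, P.supported i hne⟩)
  rw [h0]
  exact measurable_const

lemma ψ_le_one (i : Fin P.n) {x : Surface Γ} (hx : x ∈ lam.carrier) : P.ψ i x ≤ 1 := by
  rw [← P.sum_eq_one x hx]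
  exact Finset.single_le_sum (fun j _ => P.nonneg j x) (Finset.mem_univ i)

lemma length_eq_toReal : μ.length P =
    (∑ i, ∫⁻ x, ENNReal.ofReal (P.ψ i x) ∂((P.box i).lengthMeasure μ)).toReal := by
  rw [ENNReal.toReal_sum fun i _ =>
    ((P.box i).lintegral_ofReal_lengthMeasure_lt_top μ (P.measurable_ψ i)
      fun x hx => P.ψ_le_one i hx).ne]
  exact Finset.sum_congr rfl fun i _ => (P.box i).integral_integral_mul_speed μ (P.measurable_ψ i)
    (P.nonneg i) fun x hx => P.ψ_le_one i hx

lemma lintegral_ψ_eq_sum (R : FlowBox lam) {f : Surface Γ → ℝ≥0∞} (hf : Measurable f) :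
    ∫⁻ x, f x ∂(R.lengthMeasure μ) =
      ∑ j, ∫⁻ x, f x * ENNReal.ofReal (Q.ψ j x) ∂(R.lengthMeasure μ) := by
  have hm : ∀ j, Measurable fun x => f x * ENNReal.ofReal (Q.ψ j x) :=
    fun j => hf.mul (Q.measurable_ψ j).ennreal_ofReal
  rw [← lintegral_finsetSum _ fun j _ => hm j]
  refine R.lintegral_lengthMeasure_congr μ hf (Finset.measurable_fun_sum _ fun j _ => hm j)
    fun x hx => ?_
  rw [← Finset.mul_sum, ← ENNReal.ofReal_sum_of_nonneg fun j _ => Q.nonneg j x, Q.sum_eq_one x hx]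
  simp

/-- The length of a measured lamination depends neither on the flow-boxes nor on the partition of
unity. -/
lemma length_eq_length (hΓ : IsClosedSurfaceGroup Γ) : μ.length P = μ.length Q := by
  rw [P.length_eq_toReal μ, Q.length_eq_toReal μ]
  congr 1
  simp_rw [fun i => Q.lintegral_ψ_eq_sum μ (P.box i) (P.measurable_ψ i).ennreal_ofReal,
    fun j => P.lintegral_ψ_eq_sum μ (Q.box j) (Q.measurable_ψ j).ennreal_ofReal]
  rw [Finset.sum_comm]
  refine Finset.sum_congr rfl fun j _ => Finset.sum_congr rfl fun i _ => ?_
  have hsupp : (Function.support fun x => ENNReal.ofReal (P.ψ i x) * ENNReal.ofReal (Q.ψ j x)) ⊆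
      interior (P.box i).image ∩ interior (Q.box j).image := by
    intro x hx
    refine ⟨P.supported i fun h => hx ?_, Q.supported j fun h => hx ?_⟩ <;> simp [h]
  simp_rw [mul_comm (ENNReal.ofReal (Q.ψ j _))]
  rw [← setLIntegral_eq_of_support_subset hsupp, (P.box i).lengthMeasure_restrict_eq _ μ hΓ,
    setLIntegral_eq_of_support_subset hsupp]

lemma standard_le {φ : LieForm Γ} (hφ : φ.IsTangential)
    (hs : ∀ x, φ.maxSingularValue x ≤ ENNReal.ofReal √2) :
    μ.standard P φ ≤ 2 * μ.length P := by
  rw [TransverseMeasure.standard, TransverseMeasure.length, Finset.mul_sum]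
  refine Finset.sum_le_sum fun i _ => ?_
  have hψ1 : ∀ x ∈ lam.carrier, P.ψ i x ≤ 1 := fun x hx => P.ψ_le_one i hx
  rw [← integral_const_mul]
  refine integral_mono_of_integrable_nonneg
    (((P.box i).integrableOn_integral_mul_speed μ (P.measurable_ψ i) (P.nonneg i) hψ1).const_mul 2)
    (Filter.Eventually.of_forall fun s => mul_nonneg zero_le_two (integral_nonneg fun t =>
      mul_nonneg (P.nonneg i _) ((P.box i).speed_nonneg t s))) ?_
  filter_upwards [ae_restrict_of_ae ((P.box i).ae_mem_C μ)] with s hsC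
  rw [integral_Icc_eq_integral_Ioo, ← integral_const_mul]
  refine integral_mono_of_integrable_nonneg
    (((P.box i).integrableOn_mul_speed (P.measurable_ψ i) (P.nonneg i) hψ1 hsC).const_mul 2)
    (Filter.Eventually.of_forall fun t => mul_nonneg zero_le_two
      (mul_nonneg (P.nonneg i _) ((P.box i).speed_nonneg t s)))
    (Filter.Eventually.of_forall fun t => ?_)
  have := mul_le_mul_of_nonneg_left ((P.box i).killing_le hφ hs t s)
    (P.nonneg i (proj Γ ((P.box i).F (t, s))))
  simp only
  linarith

lemma standard_idForm : μ.standard P (idForm Γ) = 2 * μ.length P := by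
  rw [TransverseMeasure.standard, TransverseMeasure.length, Finset.mul_sum]
  refine Finset.sum_congr rfl fun i _ => ?_
  rw [← integral_const_mul]
  refine integral_congr_ae (Filter.Eventually.of_forall fun s => ?_)
  simp only
  rw [integral_Icc_eq_integral_Ioo, ← integral_const_mul]
  refine integral_congr_ae (Filter.Eventually.of_forall fun t => ?_)
  simp only [FlowBox.killing_idForm]
  ring

end FlowBoxPartition

end

/-- The flow-box covers and partitions of unity used for `dw = B dμ` and for the length are
arbitrary and independent of each other. -/
theorem theorem1p3 (Γ : Subgroup SOplus) (hΓ : IsClosedSurfaceGroup Γ)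
    (lam : GeodesicLamination Γ) (μ : TransverseMeasure lam)
    (P Q : FlowBoxPartition lam) :
    mass (μ.standard P) = ((2 * μ.length Q : ℝ) : EReal) := by
  rw [← P.length_eq_length Q μ hΓ]
  refine le_antisymm (iSup_le fun φ => iSup₂_le fun hφ hs => ?_) ?_
  · exact EReal.coe_le_coe_iff.2 (P.standard_le μ hφ hs)
  · rw [← P.standard_idForm μ]
    exact le_iSup_of_le (idForm Γ) (le_iSup₂_of_le (idForm_isTangential Γ)
      (idForm_maxSingularValue_le Γ) le_rfl)
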